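/- **Setting.** Write $D(r)=\{y\in\mathbb C:|y|<r\}$ and $\mathcal B(r)=\{\xi\in\mathbb R^2:\|\xi\|<r\}$, identify $\mathbb R^2=\mathbb C$, and let $y=u_1+\sqrt{-1}\,u_2$. Let $0<\delta_0\le \tfrac12$ and let $h$ be a harmonic function on $D(\delta_0)$ with $|h|\le \frac1{10\pi}\log\delta_0^{-1}$ there. For $s>0$ put $$V_s(u)=\frac1{4\pi}\sum_{n\in\mathbb Z\setminus\{0\}}\Big(\frac1{\sqrt{u_1^2+u_2^2+(u_3-sn)^2}}-\frac1{s|n|}\Big)+\frac1{4\pi|u|}+a_s+\frac{h(u_1,u_2)}s,\qquad a_s=\frac{\gamma_{\rm Euler}-\log(2s)}{2\pi s},$$ a function which is $s$-periodic in $u_3$. Let $X_{\rm OV}$ be the Ooguri–Vafa space over $D(\delta_0)$: a smooth 4-manifold with a smooth circle action and a map $(u_1,u_2,u_3)$ onto $D(\delta_0)\times\mathbb R/s\mathbb Z$ which, off a single fixed point $0_{\rm OV}$ lying over $(0,0)$, is a principal $S^1$-bundle over $(D(\delta_0)\times\mathbb R/s\mathbb Z)\setminus\{(0,0)\}$ with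 a connection form $\alpha$ (equal to $1$ on the generator of the action) satisfying $d\alpha/2\pi=\star dV_s$, and such that the forms $$\omega_{i,s}=du_i\wedge\frac{\alpha}{2\pi}+V_s\,du_j\wedge du_k,\qquad (i,j,k)\text{ cyclic in }(1,2,3),$$ extend smoothly over $0_{\rm OV}$ and form a hyper-Kähler triple, $\omega_{i,s}=g_s^{\rm OV}(J_{i,s}\cdot,\cdot)$, $J_{1,s}J_{2,s}=J_{3,s}$ (and cyclically), with hyper-Kähler metric $g_s^{\rm OV}$ (in particular $V_s>0$). Let $\mu_{\rm OV}=u_1+\sqrt{-1}\,u_2$, let $\gamma_s=J_{1,s}d\phi_s$, where $(J\beta)(v)=\beta(Jv)$ and $\phi_s(u)=-\int_0^{u_1}tV_s(t,u_2,u_3)\,dt+\psi_s(u_2,u_3)$ with $$\psi_s(u_2,u_3)=-\frac1{4\pi}\sum_{n\ne0}\Big(\sqrt{u_2^2+(u_3-sn)^2}-\frac{u_2^2}{2s|n|}+\frac{|n|}n(u_3-sn)\Big)-\frac{\sqrt{u_2^2+u_3^2}}{4\pi}-\frac{a_su_2^2}2+\frac{u_3^2-u_2^2}{4\pi s}-\int_0^{u_2}\!\!\int_0^{t'}\frac{h(0,t)}s\,dt\,dt'.$$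 Over $D(\delta_0)\setminus\{0\}$ let $V_f=\operatorname{Ker}d\mu_{\rm OV}$, let $V_f^\perp$ be its $g_s^{\rm OV}$-orthogonal complement, and let $g_\perp=g_s^{\rm OV}|_{V_f^\perp}$, $\gamma_f=\gamma_s|_{V_f}$, $\gamma_\perp=\gamma_s|_{V_f^\perp}$. Let $\zeta_s(y)=\sqrt{\frac{\log|y|^{-1}}{2\pi s}}\cdot y$ for $y\in D(\delta_0)$ (with $\zeta_s(0)=0$), let $|d\xi|^2$ be the Euclidean metric of $\mathbb R^2$ and $\mathbf r(\xi)=\|\xi\|$. **Proposition.** For every $R>0$ there is $s_R>0$, and for all $R>0$ and $0<s\le s_R$ there are positive constants $C_{s,R},\sigma_s,\delta_{s,R}$ ($\sigma_s$ not depending on $R$), depending otherwise only on $\delta_0$ and $h$, with $$\lim_{s\to0}C_{s,R}=1,\qquad \lim_{s\to0}\delta_{s,R}=\lim_{s\to0}\sigma_s=0\qquad\text{for every }R>0,$$ such that the following holds at every point of $X_{\rm OV}$ over $y=\mu_{\rm OV}(\cdot)\in D(\delta_0)\setminus\{0\}$. If $y\in\zeta_s^{-1}(\mathcal B(3R))$,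 then $$|\gamma_\perp|_{g_s^{\rm OV}}\le\delta_{s,R},\qquad |\gamma_\perp|_{(\zeta_s\circ\mu_{\rm OV})^*|d\xi|^2}\le\delta_{s,R};$$ and if $y\in\zeta_s^{-1}(\mathcal B(3R)\setminus\mathcal B(\sigma_s))$, then, with the metrics compared on $V_f^\perp$, $$C_{s,R}^{-1}(\zeta_s\circ\mu_{\rm OV})^*|d\xi|^2\le g_\perp\le C_{s,R}(\zeta_s\circ\mu_{\rm OV})^*|d\xi|^2,$$ $$C_{s,R}^{-1}(\zeta_s\circ\mu_{\rm OV})^*\mathbf r^2\le|\gamma_f|^2_{g_s^{\rm OV}}\le C_{s,R}(\zeta_s\circ\mu_{\rm OV})^*\mathbf r^2.$$ -/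

import Mathlib

open scoped Manifold ContDiff ENNReal

noncomputable section

namespace OoguriVafa

/-! ### Functions on `ℝ³`, with coordinates `u = (u₁, u₂, u₃) = (u 0, u 1, u 2)` -/

/-- The partial derivative `∂f/∂uᵢ` of a function on `ℝ³`. -/
def partialDeriv (f : (Fin 3 → ℝ) → ℝ) (i : Fin 3) (u : Fin 3 → ℝ) : ℝ :=
  deriv (fun t => f (Function.update u i t)) (u i)

/-- `√(u₁² + u₂² + (u₃ - a)²)`, the Euclidean distance of `u` from `(0, 0, a)`. -/
def dist₃ (a : ℝ) (u : Fin 3 → ℝ) : ℝ :=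
  Real.sqrt (u 0 ^ 2 + u 1 ^ 2 + (u 2 - a) ^ 2)

/-- The normalizing constant `a_s = (γ - log (2s)) / (2πs)`, with `γ` Euler's constant. -/
def aConst (s : ℝ) : ℝ :=
  (Real.eulerMascheroniConstant - Real.log (2 * s)) / (2 * Real.pi * s)

/-- The harmonic function `V_s` of the Gibbons-Hawking ansatz,
`V_s(u) = (1/4π) ∑_{n ≠ 0} (1/√(u₁² + u₂² + (u₃ - sn)²) - 1/(s|n|)) + 1/(4π|u|) + a_s + h(u₁,u₂)/s`.
-/
def V (h : ℂ → ℝ) (s : ℝ) (u : Fin 3 → ℝ) : ℝ :=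
  1 / (4 * Real.pi) *
      (∑' n : {n : ℤ // n ≠ 0}, (1 / dist₃ (s * (n : ℤ)) u - 1 / (s * |((n : ℤ) : ℝ)|)))
    + 1 / (4 * Real.pi * dist₃ 0 u) + aConst s + h ⟨u 0, u 1⟩ / s

/-- The function `ψ_s(u₂, u₃)`, written with `a = u₂` and `b = u₃`. -/
def psi (h : ℂ → ℝ) (s a b : ℝ) : ℝ :=
  -(1 / (4 * Real.pi)) *
      (∑' n : {n : ℤ // n ≠ 0},
        (Real.sqrt (a ^ 2 + (b - s * (n : ℤ)) ^ 2) - a ^ 2 / (2 * s * |((n : ℤ) : ℝ)|)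
          + |((n : ℤ) : ℝ)| / ((n : ℤ) : ℝ) * (b - s * (n : ℤ))))
    - Real.sqrt (a ^ 2 + b ^ 2) / (4 * Real.pi) - aConst s * a ^ 2 / 2
    + (b ^ 2 - a ^ 2) / (4 * Real.pi * s)
    - ∫ t' in (0 : ℝ)..a, ∫ t in (0 : ℝ)..t', h ⟨0, t⟩ / s

/-- The potential `φ_s(u) = -∫₀^{u₁} t V_s(t, u₂, u₃) dt + ψ_s(u₂, u₃)`.
It is `s`-periodic in `u₃`. -/
def phi (h : ℂ → ℝ) (s : ℝ) (u : Fin 3 → ℝ) : ℝ :=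
  -(∫ t in (0 : ℝ)..(u 0), t * V h s ![t, u 1, u 2]) + psi h s (u 1) (u 2)

/-- The rescaling map `ζ_s(y) = √(log |y|⁻¹ / (2πs)) · y`, where `ℝ² = ℂ`. -/
def zeta (s : ℝ) (y : ℂ) : ℂ :=
  (Real.sqrt (Real.log ‖y‖⁻¹ / (2 * Real.pi * s)) : ℝ) * y

/-! ### Differential forms on a smooth 4-manifold -/

/-- The model space of 4-manifolds. -/
abbrev E4 := EuclideanSpace ℝ (Fin 4)

section Forms

variable (X : Type*) [TopologicalSpace X] [ChartedSpace E4 X]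

/-- A (not necessarily smooth) 1-form. -/
abbrev OneForm := ∀ x : X, TangentSpace (𝓡 4) x →L[ℝ] ℝ

/-- A (not necessarily smooth or symmetric or alternating) covariant 2-tensor. -/
abbrev TwoTensor := ∀ x : X, TangentSpace (𝓡 4) x →L[ℝ] TangentSpace (𝓡 4) x →L[ℝ] ℝ

variable {X}

/-- The component along the constant vector field `e` of a 1-form `α`, expressed in the preferred
chart at `x`: at `p` it is the value at `e` of the pullback of `α` by the inverse of that chart. -/
def OneForm.inChart (α : OneForm X) (x : X) (e p : E4) : ℝ :=
  α ((extChartAt (𝓡 4) x).symm p) (mfderiv 𝓘(ℝ, E4) (𝓡 4) (extChartAt (𝓡 4) x).symm p e)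

/-- The component along the constant vector fields `e, f` of a 2-tensor, expressed in the preferred
chart at `x`. -/
def TwoTensor.inChart (b : TwoTensor X) (x : X) (e f p : E4) : ℝ :=
  b ((extChartAt (𝓡 4) x).symm p) (mfderiv 𝓘(ℝ, E4) (𝓡 4) (extChartAt (𝓡 4) x).symm p e)
    (mfderiv 𝓘(ℝ, E4) (𝓡 4) (extChartAt (𝓡 4) x).symm p f)

/-- Smoothness of a 1-form on an open set `W`: its components in charts are smooth. -/
def OneForm.SmoothOn (α : OneForm X) (W : Set X) : Prop :=
  ∀ x e, ContDiffOn ℝ ∞ (α.inChart x e)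
    ((extChartAt (𝓡 4) x).target ∩ (extChartAt (𝓡 4) x).symm ⁻¹' W)

/-- Smoothness of a 2-tensor on the whole manifold: its components in charts are smooth. -/
def TwoTensor.Smooth (b : TwoTensor X) : Prop :=
  ∀ x e f, ContDiffOn ℝ ∞ (b.inChart x e f) (extChartAt (𝓡 4) x).target

/-- The exterior derivative `dα(v, v') = v(α(v')) - v'(α(v))` of a 1-form at `x`, where `v, v'` are
extended to constant vector fields in the preferred chart at `x`. (The derivative at `x` of this
chart is the identification of the tangent space at `x` with `E4`.) -/
def OneForm.d (α : OneForm X) (x : X) (v v' : TangentSpace (𝓡 4) x) : ℝ :=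
  fderiv ℝ (α.inChart x v') (extChartAt (𝓡 4) x x) v -
    fderiv ℝ (α.inChart x v) (extChartAt (𝓡 4) x x) v'

/-- The value `(β ∧ γ)(v, w)` of the wedge product of two covectors. -/
def wedge {T : Type*} [AddCommGroup T] [Module ℝ T] [TopologicalSpace T]
    (β γ : T →L[ℝ] ℝ) (v w : T) : ℝ :=
  β v * γ w - β w * γ v

/-! Here `μ = u₁ + i u₂` is complex valued, and the coordinate `u₃`, which takes values in
`ℝ/sℤ`, is encoded by the unit complex number `w = exp (2πi u₃ / s)`. -/

/-- The coordinates `(u₁, u₂, u₃)`, where the representative of `u₃ ∈ ℝ/sℤ` in `(-s/2, s/2]` is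
taken. -/
def coord (s : ℝ) (μ w : X → ℂ) (x : X) : Fin 3 → ℝ :=
  ![(μ x).re, (μ x).im, s / (2 * Real.pi) * Complex.arg (w x)]

/-- The 1-forms `du₁, du₂, du₃`, where `du₃ = (s / 2π) Im (w̄ dw)`. -/
def du (s : ℝ) (μ w : X → ℂ) (i : Fin 3) : OneForm X := fun x =>
  (![Complex.reCLM.comp (mvfderiv (𝓡 4) μ x),
     Complex.imCLM.comp (mvfderiv (𝓡 4) μ x),
     (s / (2 * Real.pi)) • Complex.imCLM.comp
        ((starRingEnd ℂ (w x)) • mvfderiv (𝓡 4) w x)] :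
    Fin 3 → (TangentSpace (𝓡 4) x →L[ℝ] ℝ)) i

end Forms

/-! ### The Ooguri-Vafa space and its hyper-Kähler metric -/

/-- `X` is the Ooguri-Vafa space `X_OV` over the disc `D(δ₀)`, with fibres of area `s`, built from
the harmonic function `h`, together with its hyper-Kähler structure `(g, J₁, J₂, J₃)`.

Away from one point `o`, the space is a principal circle bundle over
`(D(δ₀) × ℝ/sℤ) ∖ {(0, 0)}` carrying a connection form `α` with curvature `dα = 2π ⋆dV_s`; and
the 2-forms `ωᵢ = duᵢ ∧ α/2π + V_s duⱼ ∧ duₖ`, `(i, j, k)` cyclic, extend smoothly over `o` and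
form a hyper-Kähler triple. The metric `g` and the complex structures `Jᵢ` are determined
by the `ωᵢ`; their smoothness, and the closedness of the `ωᵢ`, follow from the conditions below, and
so does `V_s > 0`. Indices in `Fin 3` are cyclic, and `0, 1, 2` stand for `1, 2, 3`. -/
structure OVSpace (h : ℂ → ℝ) (δ₀ s : ℝ) (X : Type*) [TopologicalSpace X] [ChartedSpace E4 X]
    [MulAction Circle X] where
  /-- the critical point of the fibration -/
  o : X
  /-- the elliptic fibration `μ_OV = u₁ + i u₂` -/
  μ : X → ℂ
  /-- the circle valued function `exp (2πi u₃ / s)` -/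
  w : X → ℂ
  norm_w : ∀ x, ‖w x‖ = 1
  smooth_μ : ContMDiff (𝓡 4) 𝓘(ℝ, ℂ) ∞ μ
  smooth_w : ContMDiff (𝓡 4) 𝓘(ℝ, ℂ) ∞ w
  /-- the circle action is smooth -/
  smooth_smul : ContMDiff ((𝓡 1).prod (𝓡 4)) (𝓡 4) ∞ (fun p : Circle × X => p.1 • p.2)
  /-- the orbits are exactly the fibres of `(μ, w)`, which maps `X` onto `D(δ₀) × ℝ/sℤ` -/
  orbit_iff : ∀ x y, (μ x = μ y ∧ w x = w y) ↔ ∃ c : Circle, c • x = y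
  mem_disc : ∀ x, ‖μ x‖ < δ₀
  surjective : ∀ y z : ℂ, ‖y‖ < δ₀ → ‖z‖ = 1 → ∃ x, μ x = y ∧ w x = z
  /-- `o` lies over `(0, 0)` -/
  apply_o : μ o = 0 ∧ w o = 1
  /-- `o` is a fixed point -/
  smul_o : ∀ c : Circle, c • o = o
  /-- the action is free away from `o` -/
  free : ∀ x, x ≠ o → ∀ c : Circle, c • x = x → c = 1
  /-- `(u₁, u₂, u₃)` is a submersion away from `o` -/
  submersion : ∀ x, x ≠ o → Function.Surjective
    (fun (v : TangentSpace (𝓡 4) x) (i : Fin 3) => du s μ w i x v)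
  /-- the connection form; its value at `o` is irrelevant -/
  α : OneForm X
  smooth_α : α.SmoothOn {o}ᶜ
  /-- `α` is invariant under the circle action -/
  invariant_α : ∀ (c : Circle) (x : X), x ≠ o → ∀ v : TangentSpace (𝓡 4) x,
    α (c • x) (mfderiv (𝓡 4) (𝓡 4) (fun z : X => c • z) x v) = α x v
  /-- `α` takes the value `1` on the generator of the circle action -/
  α_generator : ∀ x, x ≠ o →
    α (Circle.exp 0 • x)
      (mfderiv 𝓘(ℝ, ℝ) (𝓡 4) (fun t : ℝ => Circle.exp t • x) 0 (1 : ℝ)) = 1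
  /-- the curvature equation `dα / 2π = ⋆dV_s` -/
  curvature : ∀ x, x ≠ o → ∀ v v' : TangentSpace (𝓡 4) x,
    α.d x v v' / (2 * Real.pi) =
      ∑ i : Fin 3, partialDeriv (V h s) i (coord s μ w x) *
        wedge (du s μ w (i + 1) x) (du s μ w (i + 2) x) v v'
  /-- the three Kähler forms `ω₁, ω₂, ω₃` -/
  kahler : Fin 3 → TwoTensor X
  smooth_kahler : ∀ i, (kahler i).Smooth
  kahler_eq : ∀ i x, x ≠ o → ∀ v v' : TangentSpace (𝓡 4) x,
    kahler i x v v' =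
      wedge (du s μ w i x) ((1 / (2 * Real.pi)) • α x) v v' +
        V h s (coord s μ w x) * wedge (du s μ w (i + 1) x) (du s μ w (i + 2) x) v v'
  /-- the hyper-Kähler metric -/
  g : TwoTensor X
  g_symm : ∀ x (v v' : TangentSpace (𝓡 4) x), g x v v' = g x v' v
  g_pos : ∀ x (v : TangentSpace (𝓡 4) x), v ≠ 0 → 0 < g x v v
  /-- the three complex structures -/
  J : Fin 3 → ∀ x : X, TangentSpace (𝓡 4) x →L[ℝ] TangentSpace (𝓡 4) x
  J_sq : ∀ i x (v : TangentSpace (𝓡 4) x), J i x (J i x v) = -v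
  J_mul : ∀ i x (v : TangentSpace (𝓡 4) x), J i x (J (i + 1) x v) = J (i + 2) x v
  g_J : ∀ i x (v v' : TangentSpace (𝓡 4) x), g x (J i x v) (J i x v') = g x v v'
  kahler_eq_g_J : ∀ i x (v v' : TangentSpace (𝓡 4) x), kahler i x v v' = g x (J i x v) v'

/-- The norm of the restriction of a covector `ℓ` to the subspace `W`, with respect to the
quadratic form `Q`: the supremum of `|ℓ v|` over `v ∈ W` with `Q v ≤ 1`. It is an extended
nonnegative number. -/
def covectorNorm {T : Type*} [AddCommGroup T] [Module ℝ T] [TopologicalSpace T]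
    (W : Submodule ℝ T) (Q : T → ℝ) (ℓ : T →L[ℝ] ℝ) : ℝ≥0∞ :=
  ⨆ (v : T) (_ : v ∈ W) (_ : Q v ≤ 1), ENNReal.ofReal |ℓ v|

namespace OVSpace

variable {h : ℂ → ℝ} {δ₀ s : ℝ} {X : Type*} [TopologicalSpace X] [ChartedSpace E4 X]
  [MulAction Circle X] (M : OVSpace h δ₀ s X)

/-- The 1-form `dφ_s = ∑ᵢ (∂φ_s/∂uᵢ) duᵢ` on the complement of the fibre over `0`. -/
def dphi : OneForm X := fun x =>
  ∑ i : Fin 3, partialDeriv (phi h s) i (coord s M.μ M.w x) • du s M.μ M.w i x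

/-- The 1-form `γ_s = J₁ dφ_s`, where `(J β)(v) = β (J v)`. -/
def gam : OneForm X := fun x => (M.dphi x).comp (M.J 0 x)

/-- The vertical space `V_f = Ker dμ`. -/
def vert (x : X) : Submodule ℝ (TangentSpace (𝓡 4) x) :=
  LinearMap.ker (mvfderiv (𝓡 4) M.μ x : TangentSpace (𝓡 4) x →ₗ[ℝ] ℂ)

/-- The orthogonal complement of the vertical space with respect to `g`. -/
def horiz (x : X) : Submodule ℝ (TangentSpace (𝓡 4) x) where
  carrier := {v | ∀ v' ∈ M.vert x, M.g x v v' = 0}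
  add_mem' ha hb v' hv' := by simp [ha v' hv', hb v' hv']
  zero_mem' v' _ := by simp
  smul_mem' c v hv v' hv' := by simp [hv v' hv']

/-- The quadratic form `v ↦ g_s(v, v)` of the hyper-Kähler metric. -/
def gQuad (x : X) (v : TangentSpace (𝓡 4) x) : ℝ := M.g x v v

/-- The quadratic form of the pulled back Euclidean metric `(ζ_s ∘ μ)^* |dξ|²`. -/
def pullQuad (x : X) (v : TangentSpace (𝓡 4) x) : ℝ :=
  ‖mvfderiv (𝓡 4) (fun z => zeta s (M.μ z)) x v‖ ^ 2

end OVSpace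

end OoguriVafa

end

open scoped Manifold ContDiff ENNReal

noncomputable section

namespace OoguriVafa

/-! Off the fixed point everything is linear algebra in the coframe `du₁, du₂, du₃, α/2π`. The
Kähler forms and the quaternion relations force g = V(du₁² + du₂² + du₃²) + V⁻¹(α/2π)² (`g_eq`) and
γ = -(∂₁φ/V) α/2π - ∂₂φ du₃ + ∂₃φ du₂ (`gam_eq`). Hence g restricts to V|dμ|² on the horizontal
space, γ_⊥ = ∂₃φ du₂, and |γ_f|² = ((∂₁φ)² + (∂₂φ)²)/V (`covectorNorm_vert_sq`).

The potential is nearly radial in (u₁, u₂). Differentiating a distance in q = u₁² + u₂² gives half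
the inverse distance, so the regularized sum of distances yields a primitive of V in q. The function
ψ supplies the value of this primitive at u₁ = 0, and φ becomes a function of (u₁² + u₂², u₃) plus
explicit quadratic and harmonic terms (`phi_eq`). Therefore ∂₁φ = -u₁V exactly and ∂₂φ = -u₂V +
O(|y|/s), while telescoping gives |∂₃φ| ≤ 1 (`abs_latticeSlope_le`).

Write L = log|y|⁻¹. Comparing sums with integrals gives 2πsV = L + O(1) for |y| ≥ s
(`abs_two_pi_mul_V_add_log_le`). The pulled back metric is (L + O(1))/(2πs) |dμ|²
(`hasFDerivAt_zeta`), and |ζ|² = L|y|²/(2πs). So g_⊥ and |γ_f|² ≈ V|y|² agree with their models up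
to relative error O(1/L). On the preimage of 𝓑(3R) one has |y| < 10R√s, so L tends to infinity
uniformly as s → 0; and |ζ| ≥ s^{1/4} forces |y| ≥ s. For γ_⊥ only the lower bound 2πsV ≥ 1 is
needed. It also holds for |y| < s, since the pole of V has the favourable sign. -/

/-! ### Lattice sums -/

/-- The regularized sum of inverse distances to the nonzero integers. -/
def latticeInv (q x : ℝ) : ℝ :=
  ∑' n : {n : ℤ // n ≠ 0}, (1 / √(q + (x - (n : ℤ)) ^ 2) - 1 / |((n : ℤ) : ℝ)|)

/-- The regularized sum of distances to the nonzero integers. -/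
def latticeDist (q x : ℝ) : ℝ :=
  ∑' n : {n : ℤ // n ≠ 0}, (√(q + (x - (n : ℤ)) ^ 2) - q / (2 * |((n : ℤ) : ℝ)|)
    + |((n : ℤ) : ℝ)| / ((n : ℤ) : ℝ) * (x - (n : ℤ)))

/-- The derivative of `latticeDist` in its second argument. -/
def latticeSlope (q x : ℝ) : ℝ :=
  ∑' n : {n : ℤ // n ≠ 0}, ((x - (n : ℤ)) / √(q + (x - (n : ℤ)) ^ 2)
    + |((n : ℤ) : ℝ)| / ((n : ℤ) : ℝ))

lemma one_le_abs_cast (n : {n : ℤ // n ≠ 0}) : 1 ≤ |((n : ℤ) : ℝ)| := by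
  exact_mod_cast Int.one_le_abs n.2

lemma summable_inv_sq (C : ℝ) : Summable fun n : {n : ℤ // n ≠ 0} => C / ((n : ℤ) : ℝ) ^ 2 := by
  have h := (Real.summable_one_div_int_pow (p := 2)).2 (by norm_num)
  have h2 := (h.subtype {n : ℤ | n ≠ 0}).mul_left C
  refine h2.congr fun n => ?_
  simp [div_eq_mul_inv]

/-- Since |x - m| ≥ |m|/4, the claim follows from 1/16 - 1/32 > 0 with room to spare: m²/16 - 1/32 ≥
m²/36 for |m| ≥ 1. Slightly negative q and |x| up to 3/4 are admitted so that q = 0 and the period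
|x| ≤ 1/2 lie in the interior of the domains of termwise differentiation. -/
lemma sq_div_le_radicand {x q m : ℝ} (hx : |x| ≤ 3 / 4) (hm : 1 ≤ |m|) (hq : -(1 / 32) ≤ q) :
    m ^ 2 / 36 ≤ q + (x - m) ^ 2 := by
  have h1 : |m| - |x| ≤ |x - m| := by
    rw [abs_sub_comm]; exact abs_sub_abs_le_abs_sub m x
  have h2 : |m| / 4 ≤ |x - m| := by linarith
  have h3 : (|m| / 4) ^ 2 ≤ |x - m| ^ 2 := by gcongr
  rw [sq_abs, div_pow, sq_abs] at h3
  have h4 : 1 ≤ m ^ 2 := by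
    rw [← sq_abs]; nlinarith
  linarith

lemma radicand_pos {x q m : ℝ} (hx : |x| ≤ 3 / 4) (hm : 1 ≤ |m|) (hq : -(1 / 32) ≤ q) :
    0 < q + (x - m) ^ 2 := by
  refine lt_of_lt_of_le ?_ (sq_div_le_radicand hx hm hq)
  rw [← sq_abs]; positivity

lemma abs_div_six_le_sqrt {x q m : ℝ} (hx : |x| ≤ 3 / 4) (hm : 1 ≤ |m|) (hq : -(1 / 32) ≤ q) :
    |m| / 6 ≤ √(q + (x - m) ^ 2) := by
  apply Real.le_sqrt_of_sq_le
  refine le_trans (le_of_eq ?_) (sq_div_le_radicand hx hm hq)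
  rw [div_pow, sq_abs]; norm_num

/-- With r the square root, the difference is (m² - r²)/(r|m|(r + |m|)): the numerator is O(|m|) and
the denominator is at least of order |m|³. Uniformity in q ≤ Q makes this a Weierstrass majorant. -/
lemma norm_inv_sub_inv_le {x q m Q : ℝ} (hx : |x| ≤ 3 / 4) (hm : 1 ≤ |m|) (hq : -(1 / 32) ≤ q)
    (hQ : q ≤ Q) : ‖1 / √(q + (x - m) ^ 2) - 1 / |m|‖ ≤ (6 * (4 + |Q|)) / m ^ 2 := by
  set r := √(q + (x - m) ^ 2) with hr
  have hr6 : |m| / 6 ≤ r := abs_div_six_le_sqrt hx hm hq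
  have hm0 : 0 < |m| := by linarith
  have hr0 : 0 < r := by linarith
  have hrsq : r ^ 2 = q + (x - m) ^ 2 := Real.sq_sqrt (radicand_pos hx hm hq).le
  have e : 1 / r - 1 / |m| = (m ^ 2 - r ^ 2) / (r * |m| * (r + |m|)) := by
    rw [← sq_abs m]; field_simp; ring
  have hnum : |m ^ 2 - r ^ 2| ≤ (4 + |Q|) * |m| := by
    rw [hrsq]
    have : m ^ 2 - (q + (x - m) ^ 2) = 2 * (x * m) - x ^ 2 - q := by ring
    rw [this]
    have h1 : |x * m| ≤ 3 / 4 * |m| := by rw [abs_mul]; gcongr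
    have h2 : x ^ 2 ≤ 1 := by rw [← sq_abs]; nlinarith [abs_nonneg x]
    have h3 := le_abs_self Q
    have h4 : |Q| ≤ |Q| * |m| := le_mul_of_one_le_right (abs_nonneg _) hm
    have h5 := abs_le.1 h1
    have := sq_nonneg x
    rw [abs_le]; constructor <;> nlinarith
  rw [e, Real.norm_eq_abs, abs_div, abs_of_pos (by positivity : 0 < r * |m| * (r + |m|))]
  rw [div_le_div_iff₀ (by positivity) (by rw [← sq_abs]; positivity)]
  calc |m ^ 2 - r ^ 2| * m ^ 2 ≤ (4 + |Q|) * |m| * m ^ 2 := by gcongr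
    _ = (4 + |Q|) * |m| * |m| ^ 2 := by rw [sq_abs]
    _ = (4 + |Q|) * (|m| * |m| * |m|) := by ring
    _ ≤ (4 + |Q|) * ((6 * r) * |m| * (r + |m|)) := by
      gcongr <;> linarith
    _ = _ := by ring

lemma sign_mul_sub {x m : ℝ} (hx : |x| ≤ 3 / 4) (hm : 1 ≤ |m|) :
    |m| / m * (x - m) = -|x - m| := by
  have hx' := abs_le.1 hx
  rcases le_total 0 m with h | h
  · rw [abs_of_nonneg h] at hm ⊢
    rw [abs_of_nonpos (by linarith), div_self (by linarith)]; ring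
  · rw [abs_of_nonpos h] at hm ⊢
    rw [abs_of_nonneg (by linarith), neg_div, div_self (by linarith)]; ring

/-- Up to sign the term is (r - |x - m|)/r with r the square root. Rationalizing bounds it by q/r²,
and r ≥ |m|/6. -/
lemma norm_slope_le {x q m Q : ℝ} (hx : |x| ≤ 3 / 4) (hm : 1 ≤ |m|) (hq : 0 ≤ q) (hQ : q ≤ Q) :
    ‖(x - m) / √(q + (x - m) ^ 2) + |m| / m‖ ≤ (36 * Q) / m ^ 2 := by
  set r := √(q + (x - m) ^ 2) with hr
  have hr6 : |m| / 6 ≤ r := abs_div_six_le_sqrt hx hm (by linarith)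
  have hm0 : 0 < |m| := by linarith
  have hm1 : m ≠ 0 := abs_pos.1 hm0
  have hr0 : 0 < r := by linarith
  have hrsq : r ^ 2 = q + (x - m) ^ 2 := Real.sq_sqrt (radicand_pos hx hm (by linarith)).le
  have hs := sign_mul_sub hx hm
  have hone : |(|m| / m)| = 1 := by rw [abs_div, abs_abs]; exact div_self hm0.ne'
  have hsq : (|m| / m) * (|m| / m) = 1 := by
    rw [← abs_mul_abs_self, hone, one_mul]
  have hrx : |x - m| ≤ r := by
    rw [hr, ← Real.sqrt_sq_eq_abs]; apply Real.sqrt_le_sqrt; linarith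
  have e : (x - m) / r + |m| / m = (|m| / m) * ((r - |x - m|) / r) := by
    have : x - m = (|m| / m) * (-|x - m|) := by rw [← hs, ← mul_assoc, hsq, one_mul]
    calc (x - m) / r + |m| / m = (|m| / m) * (-|x - m|) / r + |m| / m := by rw [← this]
      _ = _ := by rw [sub_div, div_self hr0.ne']; ring
  rw [e, norm_mul, Real.norm_eq_abs, hone, one_mul, Real.norm_eq_abs,
    abs_of_nonneg (div_nonneg (by linarith) hr0.le)]
  have h1 : (r - |x - m|) * r ≤ q := by
    have : r ^ 2 = q + |x - m| ^ 2 := by rw [sq_abs, hrsq]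
    nlinarith [abs_nonneg (x - m)]
  rw [div_le_div_iff₀ hr0 (by rw [← sq_abs]; positivity), ← sq_abs]
  have h2 : |m| ^ 2 ≤ 36 * r ^ 2 := by nlinarith
  have h3 : 0 ≤ r - |x - m| := by linarith
  calc (r - |x - m|) * |m| ^ 2 ≤ (r - |x - m|) * (36 * r ^ 2) := by gcongr
    _ = 36 * ((r - |x - m|) * r) * r := by ring
    _ ≤ 36 * Q * r := by gcongr; linarith

lemma summable_latticeInv {x q : ℝ} (hx : |x| ≤ 3 / 4) (hq : -(1 / 32) ≤ q) :
    Summable fun n : {n : ℤ // n ≠ 0} =>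
      (1 / √(q + (x - (n : ℤ)) ^ 2) - 1 / |((n : ℤ) : ℝ)|) :=
  .of_norm_bounded (summable_inv_sq _)
    fun n => norm_inv_sub_inv_le hx (one_le_abs_cast n) hq le_rfl

lemma summable_latticeSlope {x q : ℝ} (hx : |x| ≤ 3 / 4) (hq : 0 ≤ q) :
    Summable fun n : {n : ℤ // n ≠ 0} =>
      ((x - (n : ℤ)) / √(q + (x - (n : ℤ)) ^ 2) + |((n : ℤ) : ℝ)| / ((n : ℤ) : ℝ)) :=
  .of_norm_bounded (summable_inv_sq _)
    fun n => norm_slope_le hx (one_le_abs_cast n) hq le_rfl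

/-! ### Termwise differentiation of the lattice sums. -/

lemma hasDerivAt_distTerm_left {x q m : ℝ} (hx : |x| ≤ 3 / 4) (hm : 1 ≤ |m|)
    (hq : -(1 / 32) ≤ q) :
    HasDerivAt (fun q => √(q + (x - m) ^ 2) - q / (2 * |m|) + |m| / m * (x - m))
      ((1 / √(q + (x - m) ^ 2) - 1 / |m|) / 2) q := by
  have h1 := ((hasDerivAt_id q).add_const ((x - m) ^ 2)).sqrt (radicand_pos hx hm hq).ne'
  have h2 := (h1.sub ((hasDerivAt_id q).div_const (2 * |m|))).add_const (|m| / m * (x - m))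
  refine h2.congr_deriv ?_
  simp only [id]
  have : √(q + (x - m) ^ 2) ≠ 0 := (Real.sqrt_pos.2 (radicand_pos hx hm hq)).ne'
  field_simp

lemma hasDerivAt_distTerm_right {x q m : ℝ} (hx : |x| ≤ 3 / 4) (hm : 1 ≤ |m|)
    (hq : -(1 / 32) ≤ q) :
    HasDerivAt (fun x => √(q + (x - m) ^ 2) - q / (2 * |m|) + |m| / m * (x - m))
      ((x - m) / √(q + (x - m) ^ 2) + |m| / m) x := by
  have h0 : HasDerivAt (fun x : ℝ => x - m) 1 x := (hasDerivAt_id x).sub_const m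
  have h1 := ((h0.pow 2).const_add q).sqrt (radicand_pos hx hm hq).ne'
  have h2 := (h1.sub_const (q / (2 * |m|))).add (h0.const_mul (|m| / m))
  refine h2.congr_deriv ?_
  have : √(q + (x - m) ^ 2) ≠ 0 := (Real.sqrt_pos.2 (radicand_pos hx hm hq)).ne'
  simp
  field_simp

lemma distTerm_zero {x m : ℝ} (hx : |x| ≤ 3 / 4) (hm : 1 ≤ |m|) :
    √(0 + (x - m) ^ 2) - 0 / (2 * |m|) + |m| / m * (x - m) = 0 := by
  rw [sign_mul_sub hx hm, zero_add, Real.sqrt_sq_eq_abs]; simp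

/-- The counterterms make every term vanish at q = 0, and the q-derivatives have a summable
majorant, so summability propagates from q = 0 along the interval. -/
lemma summable_latticeDist {x q : ℝ} (hx : |x| ≤ 3 / 4) (hq : -(1 / 32) < q) :
    Summable fun n : {n : ℤ // n ≠ 0} => (√(q + (x - (n : ℤ)) ^ 2) - q / (2 * |((n : ℤ) : ℝ)|)
    + |((n : ℤ) : ℝ)| / ((n : ℤ) : ℝ) * (x - (n : ℤ))) := by
  refine summable_of_summable_hasDerivAt_of_isPreconnected
    (g := fun n : {n : ℤ // n ≠ 0} => fun q => (√(q + (x - (n : ℤ)) ^ 2)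
      - q / (2 * |((n : ℤ) : ℝ)|) + |((n : ℤ) : ℝ)| / ((n : ℤ) : ℝ) * (x - (n : ℤ))))
    (t := Set.Ioo (-(1 / 32)) (|q| + 1)) (y₀ := 0)
    (summable_inv_sq (6 * (4 + |(|q| + 1)|))) isOpen_Ioo isPreconnected_Ioo
    (fun n y hy => hasDerivAt_distTerm_left hx (one_le_abs_cast n) hy.1.le)
    (fun n y hy => ?_) ?_ ?_ ?_
  · have := norm_inv_sub_inv_le hx (one_le_abs_cast n) hy.1.le hy.2.le
    rw [norm_div]
    refine le_trans (div_le_self (norm_nonneg _) (by norm_num)) this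
  · constructor <;> [norm_num; positivity]
  · refine summable_zero.congr fun n => ?_
    rw [distTerm_zero hx (one_le_abs_cast n)]
  · exact ⟨hq, by linarith [le_abs_self q]⟩

lemma hasDerivAt_latticeDist_left {x q : ℝ} (hx : |x| ≤ 3 / 4) (hq : -(1 / 32) < q) :
    HasDerivAt (fun q => latticeDist q x) (latticeInv q x / 2) q := by
  have := hasDerivAt_tsum_of_isPreconnected
    (g := fun n : {n : ℤ // n ≠ 0} => fun q => (√(q + (x - (n : ℤ)) ^ 2)
      - q / (2 * |((n : ℤ) : ℝ)|) + |((n : ℤ) : ℝ)| / ((n : ℤ) : ℝ) * (x - (n : ℤ))))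
    (t := Set.Ioo (-(1 / 32)) (|q| + 1)) (y₀ := q) (y := q)
    (summable_inv_sq (6 * (4 + |(|q| + 1)|))) isOpen_Ioo isPreconnected_Ioo
    (fun n y hy => hasDerivAt_distTerm_left hx (one_le_abs_cast n) hy.1.le)
    (fun n y hy => ?_) ⟨hq, by linarith [le_abs_self q]⟩ (summable_latticeDist hx hq)
    ⟨hq, by linarith [le_abs_self q]⟩
  · rw [tsum_div_const] at this
    exact this
  · have := norm_inv_sub_inv_le hx (one_le_abs_cast n) hy.1.le hy.2.le
    rw [norm_div]
    refine le_trans (div_le_self (norm_nonneg _) (by norm_num)) this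

lemma hasDerivAt_latticeDist_right {x q : ℝ} (hx : |x| < 3 / 4) (hq : 0 ≤ q) :
    HasDerivAt (fun x => latticeDist q x) (latticeSlope q x) x := by
  have hI : ∀ y ∈ Set.Ioo (-(3 / 4) : ℝ) (3 / 4), |y| ≤ 3 / 4 := fun y hy => (abs_lt.2 hy).le
  exact hasDerivAt_tsum_of_isPreconnected
    (g := fun n : {n : ℤ // n ≠ 0} => fun x => (√(q + (x - (n : ℤ)) ^ 2)
      - q / (2 * |((n : ℤ) : ℝ)|) + |((n : ℤ) : ℝ)| / ((n : ℤ) : ℝ) * (x - (n : ℤ))))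
    (t := Set.Ioo (-(3 / 4)) (3 / 4)) (y₀ := x) (y := x)
    (summable_inv_sq (36 * q)) isOpen_Ioo isPreconnected_Ioo
    (fun n y hy => hasDerivAt_distTerm_right (hI y hy) (one_le_abs_cast n) (by linarith))
    (fun n y hy => norm_slope_le (hI y hy) (one_le_abs_cast n) hq le_rfl)
    (abs_lt.1 hx) (summable_latticeDist hx.le (by linarith)) (abs_lt.1 hx)

lemma continuousOn_latticeInv {x : ℝ} (hx : |x| ≤ 3 / 4) (Q : ℝ) :
    ContinuousOn (fun q => latticeInv q x) (Set.Icc 0 Q) := by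
  refine continuousOn_tsum (fun n => ?_) (summable_inv_sq (6 * (4 + |Q|))) fun n q hq =>
    norm_inv_sub_inv_le hx (one_le_abs_cast n) (by linarith [hq.1]) hq.2
  refine ContinuousOn.sub (ContinuousOn.div continuousOn_const (by fun_prop) fun q hq => ?_)
    continuousOn_const
  exact (Real.sqrt_pos.2 (radicand_pos hx (one_le_abs_cast n) (by linarith [hq.1]))).ne'

/-- Grouping n with -n lets the sign counterterms cancel and turns the 1/|n| counterterms into
harmonic numbers. -/
lemma hasSum_nat_pair {f : ℤ → ℝ} (hf : Summable fun n : {n : ℤ // n ≠ 0} => f n) :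
    HasSum (fun k : ℕ => f (k + 1) + f (-(k + 1))) (∑' n : {n : ℤ // n ≠ 0}, f n) := by
  have hs : Summable ({n : ℤ | n ≠ 0}.indicator f) := summable_subtype_iff_indicator.1 hf
  have h1 : Summable fun k : ℕ => {n : ℤ | n ≠ 0}.indicator f (k + 1) :=
    hs.comp_injective (i := fun k : ℕ => (k + 1 : ℤ)) fun a b h => by simpa using h
  have h2 : Summable fun k : ℕ => {n : ℤ | n ≠ 0}.indicator f (-(k + 1)) :=
    hs.comp_injective (i := fun k : ℕ => (-(k + 1) : ℤ)) fun a b h => by simpa using h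
  have e1 : ∀ k : ℕ, {n : ℤ | n ≠ 0}.indicator f (k + 1) = f (k + 1) := fun k =>
    Set.indicator_of_mem (by simp; omega) _
  have e2 : ∀ k : ℕ, {n : ℤ | n ≠ 0}.indicator f (-(k + 1)) = f (-(k + 1)) := fun k =>
    Set.indicator_of_mem (by simp; omega) _
  have h3 := tsum_of_add_one_of_neg_add_one h1 h2
  rw [Set.indicator_of_notMem (by simp), add_zero, ← h1.tsum_add h2] at h3
  have h4 : ∑' n : {n : ℤ // n ≠ 0}, f n = _ := (tsum_subtype {n : ℤ | n ≠ 0} f).trans h3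
  rw [h4]
  simpa only [e1, e2] using (h1.add h2).hasSum

/-! ### Bounds for the lattice sums -/

lemma div_sqrt_add_sq_mono {q a b : ℝ} (hq : 0 ≤ q) (ha : 0 < a) (hab : a ≤ b) :
    a / √(q + a ^ 2) ≤ b / √(q + b ^ 2) := by
  have hb : 0 < b := ha.trans_le hab
  rw [div_le_div_iff₀ (Real.sqrt_pos.2 (by positivity)) (Real.sqrt_pos.2 (by positivity))]
  rw [← Real.sqrt_sq ha.le, ← Real.sqrt_sq hb.le, ← Real.sqrt_mul (by positivity),
    ← Real.sqrt_mul (by positivity), Real.sq_sqrt (by positivity), Real.sq_sqrt (by positivity)]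
  apply Real.sqrt_le_sqrt
  have : a ^ 2 ≤ b ^ 2 := by gcongr
  nlinarith

lemma div_sqrt_add_sq_le_one {q a : ℝ} (hq : 0 ≤ q) : a / √(q + a ^ 2) ≤ 1 := by
  apply div_le_one_of_le₀ _ (Real.sqrt_nonneg _)
  exact Real.le_sqrt_of_sq_le (by linarith)

/-- For t > 0 the function g(t) = t/√(q + t²) increases and stays below 1. The pair ±(k+1)
contributes g(k+1+x) - g(k+1-x), with both arguments in [k+1/2, k+3/2]; the increments of g over
these intervals telescope to at most 1. -/
lemma abs_latticeSlope_le {q x : ℝ} (hq : 0 ≤ q) (hx : |x| ≤ 1 / 2) : |latticeSlope q x| ≤ 1 := by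
  have hx' := abs_le.1 hx
  have hsum := hasSum_nat_pair
    (f := fun n : ℤ => ((x - n) / √(q + (x - n) ^ 2) + |(n : ℝ)| / n))
    (summable_latticeSlope (by linarith) hq)
  set g : ℝ → ℝ := fun t => t / √(q + t ^ 2) with hg
  have hterm : ∀ k : ℕ, |(fun n : ℤ => ((x - n) / √(q + (x - n) ^ 2) + |(n : ℝ)| / n)) (k + 1)
      + (fun n : ℤ => ((x - n) / √(q + (x - n) ^ 2) + |(n : ℝ)| / n)) (-(k + 1))|
      ≤ g ((k + 1 : ℕ) + 1 / 2) - g (k + 1 / 2) := by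
    intro k
    have hk : (0 : ℝ) ≤ k := by positivity
    have e : (fun n : ℤ => ((x - n) / √(q + (x - n) ^ 2) + |(n : ℝ)| / n)) (k + 1)
      + (fun n : ℤ => ((x - n) / √(q + (x - n) ^ 2) + |(n : ℝ)| / n)) (-(k + 1))
      = g (k + 1 + x) - g (k + 1 - x) := by
      have h1 : |(k : ℝ) + 1| / (k + 1) = 1 := by
        rw [abs_of_pos (by positivity)]; exact div_self (by positivity)
      simp only [hg]
      push_cast
      rw [abs_neg, div_neg, h1, ← neg_sub ((k : ℝ) + 1) x, neg_sq, neg_div]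
      rw [show x - -((k : ℝ) + 1) = k + 1 + x by ring]
      ring
    rw [e]
    push_cast
    have a1 := div_sqrt_add_sq_mono hq (a := k + 1 / 2) (b := k + 1 - x) (by positivity)
      (by linarith)
    have a2 := div_sqrt_add_sq_mono hq (a := k + 1 / 2) (b := k + 1 + x) (by positivity)
      (by linarith)
    have a3 := div_sqrt_add_sq_mono hq (a := k + 1 - x) (b := k + 1 + 1 / 2) (by linarith)
      (by linarith)
    have a4 := div_sqrt_add_sq_mono hq (a := k + 1 + x) (b := k + 1 + 1 / 2) (by linarith)
      (by linarith)
    simp only [hg]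
    rw [abs_le]; constructor <;> linarith
  refine le_of_tendsto hsum.tendsto_sum_nat.abs (.of_forall fun N => ?_)
  refine (Finset.abs_sum_le_sum_abs _ _).trans ((Finset.sum_le_sum fun k _ => hterm k).trans ?_)
  rw [Finset.sum_range_sub (fun k : ℕ => g (k + 1 / 2))]
  have h1 : g (N + 1 / 2) ≤ 1 := div_sqrt_add_sq_le_one hq
  have h2 : 0 ≤ g ((0 : ℕ) + 1 / 2) := by simp only [hg]; positivity
  linarith

/-- A primitive of `1 / √(q + t²)`. -/
def logPrim (q t : ℝ) : ℝ := Real.log (t + √(q + t ^ 2))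

lemma add_sqrt_pos {q : ℝ} (hq : 0 < q) (t : ℝ) : 0 < t + √(q + t ^ 2) := by
  have : |t| < √(q + t ^ 2) := by
    rw [← Real.sqrt_sq_eq_abs]; exact Real.sqrt_lt_sqrt (sq_nonneg t) (by linarith)
  linarith [neg_abs_le t]

lemma hasDerivAt_logPrim {q : ℝ} (hq : 0 < q) (t : ℝ) :
    HasDerivAt (logPrim q) (1 / √(q + t ^ 2)) t := by
  have hp : 0 < q + t ^ 2 := by positivity
  have h1 := (((hasDerivAt_id t).pow 2).const_add q).sqrt (by simpa using hp.ne')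
  have h2 := ((hasDerivAt_id t).add h1).log (by simpa using (add_sqrt_pos hq t).ne')
  refine h2.congr_deriv ?_
  have h3 := add_sqrt_pos hq t
  have h4 := Real.sqrt_pos.2 hp
  simp
  field_simp
  ring

/-- The mean value theorem lets a summand be compared with a unit increment of the primitive, so
that the lattice sum is bounded by telescoping sums. -/
lemma exists_logPrim_sub {q : ℝ} (hq : 0 < q) (a : ℝ) :
    ∃ c ∈ Set.Ioo a (a + 1), 1 / √(q + c ^ 2) = logPrim q (a + 1) - logPrim q a := by
  obtain ⟨c, hc, h⟩ := exists_hasDerivAt_eq_slope (logPrim q) (fun t => 1 / √(q + t ^ 2))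
    (by linarith : a < a + 1)
    (fun t _ => (hasDerivAt_logPrim hq t).continuousAt.continuousWithinAt)
    (fun t _ => hasDerivAt_logPrim hq t)
  exact ⟨c, hc, by simpa using h⟩

lemma logPrim_sub_le {q a m : ℝ} (hq : 0 < q) (hm : |m| ≤ a) :
    logPrim q (a + 1) - logPrim q a ≤ 1 / √(q + m ^ 2) := by
  obtain ⟨c, hc, h⟩ := exists_logPrim_sub hq a
  rw [← h]
  apply one_div_le_one_div_of_le (Real.sqrt_pos.2 (by positivity))
  apply Real.sqrt_le_sqrt
  have : m ^ 2 ≤ c ^ 2 := sq_le_sq' (by linarith [neg_abs_le m, hc.1]) (by linarith [le_abs_self m, hc.1])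
  linarith

/-- The bound a ≥ -1/2 ensures |c| ≤ a + 1 for the mean value point c; the case a = -1/2 is needed
for the pair n = ±1. -/
lemma le_logPrim_sub {q a m : ℝ} (hq : 0 < q) (ha : -(1 / 2) ≤ a) (hm : a + 1 ≤ |m|) :
    1 / √(q + m ^ 2) ≤ logPrim q (a + 1) - logPrim q a := by
  obtain ⟨c, hc, h⟩ := exists_logPrim_sub hq a
  rw [← h]
  apply one_div_le_one_div_of_le (Real.sqrt_pos.2 (by positivity))
  apply Real.sqrt_le_sqrt
  have : c ^ 2 ≤ |m| ^ 2 := sq_le_sq' (by linarith [hc.1]) (by linarith [hc.2])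
  rw [sq_abs] at this
  linarith

lemma logPrim_le {q t : ℝ} (hq : 0 < q) (ht : 0 ≤ t) : logPrim q t ≤ Real.log (√q + 2 * t) := by
  apply Real.log_le_log (add_sqrt_pos hq t)
  have : √(q + t ^ 2) ≤ √q + t := by
    rw [Real.sqrt_le_left (by positivity)]
    nlinarith [Real.sq_sqrt hq.le, Real.sqrt_nonneg q]
  linarith

lemma le_logPrim {q t : ℝ} (ht : 0 < t) : Real.log t ≤ logPrim q t := by
  apply Real.log_le_log ht
  linarith [Real.sqrt_nonneg (q + t ^ 2)]

lemma latticeInv_pair (q x : ℝ) (k : ℕ) :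
    (fun n : ℤ => (1 / √(q + (x - n) ^ 2) - 1 / |(n : ℝ)|)) (k + 1)
      + (fun n : ℤ => (1 / √(q + (x - n) ^ 2) - 1 / |(n : ℝ)|)) (-(k + 1))
      = 1 / √(q + (x - (k + 1)) ^ 2) + 1 / √(q + (x + (k + 1)) ^ 2) - 2 * ((k : ℝ) + 1)⁻¹ := by
  push_cast
  rw [abs_neg, abs_of_pos (by positivity), sub_neg_eq_add]
  ring

lemma latticeInv_tendsto {q x : ℝ} (hq : 0 ≤ q) (hx : |x| ≤ 1 / 2) :
    Filter.Tendsto (fun N : ℕ => ∑ k ∈ Finset.range N, (1 / √(q + (x - (k + 1)) ^ 2)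
      + 1 / √(q + (x + (k + 1)) ^ 2)) - 2 * ((harmonic N : ℚ) : ℝ)) Filter.atTop
      (nhds (latticeInv q x)) := by
  have hsum := hasSum_nat_pair
    (f := fun n : ℤ => (1 / √(q + (x - n) ^ 2) - 1 / |(n : ℝ)|))
    (summable_latticeInv (by linarith) (by linarith))
  refine hsum.tendsto_sum_nat.congr fun N => ?_
  simp only [latticeInv_pair]
  rw [Finset.sum_sub_distrib, ← Finset.mul_sum, harmonic]
  push_cast
  rfl

/-- Both points x ∓ (k+1) have absolute value at most k + 3/2, so each summand dominates the
increment of the primitive over [k+3/2, k+5/2]. The divergent log N cancels against the harmonic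
number. -/
lemma le_latticeInv {q x : ℝ} (hq : 0 < q) (hx : |x| ≤ 1 / 2) :
    -2 - 2 * Real.log (√q + 3) ≤ latticeInv q x := by
  have hx' := abs_le.1 hx
  refine ge_of_tendsto (latticeInv_tendsto hq.le hx) ?_
  filter_upwards [Filter.eventually_ge_atTop 1] with N hN
  have h1 : ∀ k : ℕ, 2 * (logPrim q ((k + 1 : ℕ) + 3 / 2) - logPrim q (k + 3 / 2)) ≤
      1 / √(q + (x - (k + 1)) ^ 2) + 1 / √(q + (x + (k + 1)) ^ 2) := by
    intro k
    have a1 := logPrim_sub_le hq (a := k + 3 / 2) (m := x - (k + 1))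
      (by rw [abs_le]; constructor <;> linarith [(Nat.cast_nonneg k : (0 : ℝ) ≤ k)])
    have a2 := logPrim_sub_le hq (a := k + 3 / 2) (m := x + (k + 1))
      (by rw [abs_le]; constructor <;> linarith [(Nat.cast_nonneg k : (0 : ℝ) ≤ k)])
    push_cast
    rw [show (k : ℝ) + 1 + 3 / 2 = k + 3 / 2 + 1 by ring]
    linarith
  have h2 := Finset.sum_le_sum fun k (_ : k ∈ Finset.range N) => h1 k
  rw [← Finset.mul_sum, Finset.sum_range_sub (fun k : ℕ => logPrim q (k + 3 / 2))] at h2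
  have h3 := harmonic_le_one_add_log N
  have h4 : Real.log N ≤ logPrim q (N + 3 / 2) :=
    (Real.log_le_log (by positivity) (by linarith)).trans (le_logPrim (by positivity))
  have h5 : logPrim q ((0 : ℕ) + 3 / 2) ≤ Real.log (√q + 3) :=
    (logPrim_le hq (by norm_num)).trans (le_of_eq (by norm_num))
  linarith

/-- The same comparison with the intervals moved inwards to [k-1/2, k+1/2]. -/
lemma latticeInv_le {q x : ℝ} (hq : 1 ≤ q) (hx : |x| ≤ 1 / 2) :
    latticeInv q x ≤ 2 * Real.log 6 - Real.log q := by
  have hx' := abs_le.1 hx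
  have hq0 : 0 < q := by linarith
  refine le_of_tendsto (latticeInv_tendsto hq0.le hx) ?_
  obtain ⟨N₀, hN₀⟩ := exists_nat_ge (√q)
  filter_upwards [Filter.eventually_ge_atTop 1, Filter.eventually_ge_atTop N₀] with N hN hN'
  have hqN : √q ≤ N := hN₀.trans (by exact_mod_cast hN')
  have h1 : ∀ k : ℕ, 1 / √(q + (x - (k + 1)) ^ 2) + 1 / √(q + (x + (k + 1)) ^ 2)
      ≤ 2 * (logPrim q ((k + 1 : ℕ) - 1 / 2) - logPrim q (k - 1 / 2)) := by
    intro k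
    have hk : (0 : ℝ) ≤ k := by positivity
    have a1 := le_logPrim_sub hq0 (a := k - 1 / 2) (m := x - (k + 1)) (by linarith)
      (by rw [le_abs]; right; linarith)
    have a2 := le_logPrim_sub hq0 (a := k - 1 / 2) (m := x + (k + 1)) (by linarith)
      (by rw [le_abs]; left; linarith)
    push_cast
    rw [show (k : ℝ) + 1 - 1 / 2 = k - 1 / 2 + 1 by ring]
    linarith
  have h2 := Finset.sum_le_sum fun k (_ : k ∈ Finset.range N) => h1 k
  rw [← Finset.mul_sum, Finset.sum_range_sub (fun k : ℕ => logPrim q (k - 1 / 2))] at h2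
  have h3 := log_add_one_le_harmonic N
  have hN1 : (1 : ℝ) ≤ N := by exact_mod_cast hN
  have h4 : logPrim q (N - 1 / 2) ≤ Real.log 3 + Real.log (N + 1 : ℕ) := by
    rw [← Real.log_mul (by norm_num) (by positivity)]
    refine (logPrim_le hq0 (by linarith)).trans (Real.log_le_log (by linarith [Real.sqrt_pos.2 hq0]) ?_)
    push_cast; linarith
  -- Here q ≥ 1 is essential: it gives √q - 1/2 ≥ √q/2 at the lower endpoint -1/2.
  have h5 : Real.log q / 2 - Real.log 2 ≤ logPrim q ((0 : ℕ) - 1 / 2) := by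
    rw [← Real.log_sqrt hq0.le, ← Real.log_div (by positivity) (by norm_num)]
    apply Real.log_le_log (by positivity)
    have a1 : √q ≤ √(q + ((0 : ℕ) - 1 / 2 : ℝ) ^ 2) := Real.sqrt_le_sqrt (by norm_num)
    have a2 : 1 ≤ √q := Real.one_le_sqrt.2 hq
    push_cast at a1 ⊢
    linarith
  have h6 : Real.log 6 = Real.log 3 + Real.log 2 := by
    rw [← Real.log_mul (by norm_num) (by norm_num)]; norm_num
  linarith

/-! ### Closed forms for the potentials -/

lemma sqrt_add_sq_eq_mul {s : ℝ} (hs : 0 < s) (p z n : ℝ) :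
    √(p + (z - s * n) ^ 2) = s * √(p / s ^ 2 + (z / s - n) ^ 2) := by
  rw [← Real.sqrt_sq hs.le, ← Real.sqrt_mul (by positivity), Real.sqrt_sq hs.le]
  congr 1
  field_simp

lemma V_eq_latticeInv (h : ℂ → ℝ) {s : ℝ} (hs : 0 < s) (u : Fin 3 → ℝ) :
    V h s u = 1 / (4 * Real.pi * s) * latticeInv ((u 0 ^ 2 + u 1 ^ 2) / s ^ 2) (u 2 / s)
      + 1 / (4 * Real.pi * √(u 0 ^ 2 + u 1 ^ 2 + u 2 ^ 2)) + aConst s + h ⟨u 0, u 1⟩ / s := by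
  have e : ∀ n : {n : ℤ // n ≠ 0}, 1 / dist₃ (s * (n : ℤ)) u - 1 / (s * |((n : ℤ) : ℝ)|) =
      1 / s * (1 / √((u 0 ^ 2 + u 1 ^ 2) / s ^ 2 + (u 2 / s - (n : ℤ)) ^ 2)
        - 1 / |((n : ℤ) : ℝ)|) := by
    intro n
    rw [dist₃, sqrt_add_sq_eq_mul hs, one_div_mul_eq_div, sub_div, div_div, div_div]
    ring
  unfold V latticeInv
  simp only [e]
  rw [tsum_mul_left, dist₃, sub_zero]
  ring

lemma psi_eq_latticeDist (h : ℂ → ℝ) {s : ℝ} (hs : 0 < s) (b z : ℝ) :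
    psi h s b z = -(s / (4 * Real.pi)) * latticeDist (b ^ 2 / s ^ 2) (z / s)
      - √(b ^ 2 + z ^ 2) / (4 * Real.pi) - aConst s * b ^ 2 / 2
      + (z ^ 2 - b ^ 2) / (4 * Real.pi * s)
      - (∫ t' in (0 : ℝ)..b, ∫ t in (0 : ℝ)..t', h ⟨0, t⟩) / s := by
  have e : ∀ n : {n : ℤ // n ≠ 0}, (√(b ^ 2 + (z - s * (n : ℤ)) ^ 2)
        - b ^ 2 / (2 * s * |((n : ℤ) : ℝ)|)
        + |((n : ℤ) : ℝ)| / ((n : ℤ) : ℝ) * (z - s * (n : ℤ))) =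
      s * (√(b ^ 2 / s ^ 2 + (z / s - (n : ℤ)) ^ 2) - b ^ 2 / s ^ 2 / (2 * |((n : ℤ) : ℝ)|)
        + |((n : ℤ) : ℝ)| / ((n : ℤ) : ℝ) * (z / s - (n : ℤ))) := by
    intro n
    have hn : |((n : ℤ) : ℝ)| ≠ 0 := by linarith [one_le_abs_cast n]
    have hn' : ((n : ℤ) : ℝ) ≠ 0 := by exact_mod_cast n.2
    rw [sqrt_add_sq_eq_mul hs]
    field_simp
  unfold psi latticeDist
  simp only [e, intervalIntegral.integral_div]
  rw [tsum_mul_left]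
  ring

lemma intervalIntegrable_div_sqrt {p : ℝ} (hp : 0 ≤ p) (a b : ℝ) :
    IntervalIntegrable (fun t : ℝ => t / √(t ^ 2 + p)) MeasureTheory.volume a b := by
  refine IntervalIntegrable.mono_fun (f := fun _ => (1 : ℝ)) intervalIntegrable_const
    (Measurable.aestronglyMeasurable (by fun_prop)) (.of_forall fun t => ?_)
  beta_reduce
  rw [norm_div, norm_one, Real.norm_eq_abs, Real.norm_eq_abs, abs_of_nonneg (Real.sqrt_nonneg _)]
  apply div_le_one_of_le₀ _ (Real.sqrt_nonneg _)
  apply Real.abs_le_sqrt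
  linarith

lemma abs_div_le_of_abs_le {s z c : ℝ} (hs : 0 < s) (hz : |z| ≤ c * s) : |z / s| ≤ c := by
  rw [abs_div, abs_of_pos hs, div_le_iff₀ hs]; exact hz

/-! ### Integrating the rotationally symmetric part of the potential. -/

/-- The part of `V` that does not involve the harmonic function, in the variables `p = u₁² + u₂²`
and `z = u₃`. -/
def baseV (s p z : ℝ) : ℝ :=
  1 / (4 * Real.pi * s) * latticeInv (p / s ^ 2) (z / s)
      + 1 / (4 * Real.pi * √(p + z ^ 2)) + aConst s

/-- The part of `phi` that does not involve the harmonic function. -/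
def basePhi (s p z : ℝ) : ℝ :=
  -(s / (4 * Real.pi)) * latticeDist (p / s ^ 2) (z / s) - √(p + z ^ 2) / (4 * Real.pi)
    - aConst s * p / 2

lemma V_eq_baseV (h : ℂ → ℝ) {s : ℝ} (hs : 0 < s) (u : Fin 3 → ℝ) :
    V h s u = baseV s (u 0 ^ 2 + u 1 ^ 2) (u 2) + h ⟨u 0, u 1⟩ / s :=
  V_eq_latticeInv h hs u

lemma hasDerivAt_basePhi_left {s p z : ℝ} (hs : 0 < s) (hz : |z| ≤ 3 / 4 * s) (hp : 0 < p) :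
    HasDerivAt (fun p => basePhi s p z) (-(baseV s p z / 2)) p := by
  have hz' := abs_div_le_of_abs_le hs hz
  have hq : -(1 / 32) < p / s ^ 2 := lt_of_lt_of_le (by norm_num) (by positivity : 0 ≤ p / s ^ 2)
  have hpz : 0 < p + z ^ 2 := by positivity
  have h1 := (hasDerivAt_latticeDist_left hz' hq).comp p ((hasDerivAt_id p).div_const (s ^ 2))
  have h2 := ((hasDerivAt_id p).add_const (z ^ 2)).sqrt hpz.ne'
  have h3 := (((h1.const_mul (-(s / (4 * Real.pi)))).sub (h2.div_const (4 * Real.pi))).sub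
    (((hasDerivAt_id p).const_mul (aConst s)).div_const 2))
  refine h3.congr_deriv ?_
  have := Real.sqrt_pos.2 hpz
  have := Real.pi_pos
  simp only [baseV, id]
  field_simp
  ring

lemma hasDerivAt_basePhi_comp_sq {s b z : ℝ} (hs : 0 < s) (hz : |z| ≤ 3 / 4 * s) {t : ℝ}
    (hp : 0 < t ^ 2 + b ^ 2) :
    HasDerivAt (fun t => basePhi s (t ^ 2 + b ^ 2) z) (-(t * baseV s (t ^ 2 + b ^ 2) z)) t := by
  have h1 := (hasDerivAt_basePhi_left hs hz hp).comp t (((hasDerivAt_id t).pow 2).add_const (b ^ 2))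
  refine h1.congr_deriv ?_
  simp
  ring

lemma hasDerivAt_basePhi_right {s p z : ℝ} (hs : 0 < s) (hz : |z| < 3 / 4 * s) (hp : 0 < p) :
    HasDerivAt (fun z => basePhi s p z) (-(1 / (4 * Real.pi)) * (latticeSlope (p / s ^ 2) (z / s)
      + z / √(p + z ^ 2))) z := by
  have hz' : |z / s| < 3 / 4 := by rw [abs_div, abs_of_pos hs, div_lt_iff₀ hs]; exact hz
  have hpz : 0 < p + z ^ 2 := by positivity
  have h1 := (hasDerivAt_latticeDist_right hz' (by positivity : 0 ≤ p / s ^ 2)).comp z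
    ((hasDerivAt_id z).div_const s)
  have h2 := (((hasDerivAt_id z).pow 2).const_add p).sqrt (by simpa using hpz.ne')
  have h3 := (((h1.const_mul (-(s / (4 * Real.pi)))).sub (h2.div_const (4 * Real.pi))).sub_const
    (aConst s * p / 2))
  refine h3.congr_deriv ?_
  have := Real.sqrt_pos.2 hpz
  have := Real.pi_pos
  simp
  field_simp
  ring

/-- The pole of `baseV` at b = z = 0 is harmless because of the factor t: the quotient t/√(t² + b² +
z²) is bounded by 1. -/
lemma intervalIntegrable_mul_baseV {s b z : ℝ} (hs : 0 < s) (hz : |z| ≤ 3 / 4 * s) (c : ℝ) :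
    IntervalIntegrable (fun t => t * baseV s (t ^ 2 + b ^ 2) z) MeasureTheory.volume 0 c := by
  have hz' := abs_div_le_of_abs_le hs hz
  have h1 : IntervalIntegrable (fun t => t * (1 / (4 * Real.pi * s)
      * latticeInv ((t ^ 2 + b ^ 2) / s ^ 2) (z / s) + aConst s)) MeasureTheory.volume 0 c := by
    apply ContinuousOn.intervalIntegrable
    refine continuousOn_id.mul (((continuousOn_const).mul ?_).add continuousOn_const)
    refine (continuousOn_latticeInv hz' ((c ^ 2 + b ^ 2) / s ^ 2)).comp
      (f := fun t => (t ^ 2 + b ^ 2) / s ^ 2) (by fun_prop) fun t ht => ?_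
    have : t ^ 2 ≤ c ^ 2 := by
      rw [sq_le_sq]
      rcases Set.mem_uIcc.1 ht with ⟨h1, h2⟩ | ⟨h1, h2⟩
      · rwa [abs_of_nonneg h1, abs_of_nonneg (h1.trans h2)]
      · rw [abs_of_nonpos h2, abs_of_nonpos (h1.trans h2)]; linarith
    exact ⟨by positivity, div_le_div_of_nonneg_right (by linarith) (by positivity)⟩
  refine (h1.add ((intervalIntegrable_div_sqrt (by positivity : 0 ≤ b ^ 2 + z ^ 2) 0 c).const_mul
    (1 / (4 * Real.pi)))).congr fun t _ => ?_
  simp only [baseV]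
  rw [← add_assoc (t ^ 2)]
  ring

lemma continuous_basePhi_comp_sq {s b z : ℝ} (hs : 0 < s) (hz : |z| ≤ 3 / 4 * s) :
    Continuous (fun t => basePhi s (t ^ 2 + b ^ 2) z) := by
  have hz' := abs_div_le_of_abs_le hs hz
  unfold basePhi
  have : Continuous fun t : ℝ => latticeDist ((t ^ 2 + b ^ 2) / s ^ 2) (z / s) := by
    rw [continuous_iff_continuousAt]
    intro t
    have hq : -(1 / 32) < (t ^ 2 + b ^ 2) / s ^ 2 := lt_of_lt_of_le (by norm_num)
      (by positivity : 0 ≤ (t ^ 2 + b ^ 2) / s ^ 2)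
    exact ContinuousAt.comp (f := fun t : ℝ => (t ^ 2 + b ^ 2) / s ^ 2)
      (hasDerivAt_latticeDist_left hz' hq).continuousAt (by fun_prop)
  fun_prop

lemma integral_mul_baseV {s b z : ℝ} (hs : 0 < s) (hz : |z| ≤ 3 / 4 * s) (c : ℝ) :
    ∫ t in (0 : ℝ)..c, t * baseV s (t ^ 2 + b ^ 2) z
      = basePhi s (b ^ 2) z - basePhi s (c ^ 2 + b ^ 2) z := by
  -- When b = 0 the derivative formula is unavailable at t = 0, so that point is excepted and only
  -- continuity is used there.
  rw [MeasureTheory.integral_eq_of_hasDerivAt_off_countable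
    (fun t => -basePhi s (t ^ 2 + b ^ 2) z) _ (Set.countable_singleton (0 : ℝ))
    (continuous_basePhi_comp_sq hs hz).neg.continuousOn (fun t ht => ?_)
    (intervalIntegrable_mul_baseV hs hz c)]
  · simp
    ring
  · have : 0 < t ^ 2 + b ^ 2 := by
      have : t ≠ 0 := ht.2
      positivity
    exact (hasDerivAt_basePhi_comp_sq hs hz this).neg.congr_deriv (neg_neg _)

/-! ### The contribution of the harmonic function -/

lemma norm_mk_lt {r a b : ℝ} (ha : |a| < r / 2) (hb : |b| < r / 2) : ‖(⟨a, b⟩ : ℂ)‖ < r :=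
  (Complex.norm_le_abs_re_add_abs_im _).trans_lt (by simp only; linarith)

lemma hasDerivAt_integral_of_continuousOn_Ioo {f : ℝ → ℝ} {r b : ℝ}
    (hf : ContinuousOn f (Set.Ioo (-r) r)) (hb : |b| < r) :
    HasDerivAt (fun x => ∫ t in (0 : ℝ)..x, f t) (f b) b := by
  have hb' := abs_lt.1 hb
  have h0 : 0 < r := (abs_nonneg b).trans_lt hb
  refine intervalIntegral.integral_hasDerivAt_right ?_ ?_ ?_
  · apply (hf.mono ?_).intervalIntegrable
    exact Set.OrdConnected.uIcc_subset Set.ordConnected_Ioo ⟨by linarith, h0⟩ hb'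
  · exact hf.stronglyMeasurableAtFilter isOpen_Ioo b hb'
  · exact hf.continuousAt (Ioo_mem_nhds hb'.1 hb'.2)

lemma continuousOn_mk_left {h : ℂ → ℝ} {r b : ℝ} (hh : ContinuousOn h (Metric.ball 0 r))
    (hb : |b| < r / 2) : ContinuousOn (fun t => h ⟨t, b⟩) (Set.Ioo (-(r / 2)) (r / 2)) := by
  refine hh.comp (f := fun t : ℝ => (⟨t, b⟩ : ℂ)) ?_ fun t ht => ?_
  · have : (fun t : ℝ => (⟨t, b⟩ : ℂ)) = fun t : ℝ => (t : ℂ) + b * Complex.I := by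
      ext t; exact Complex.mk_eq_add_mul_I t b
    rw [this]; fun_prop
  · rw [mem_ball_zero_iff]; exact norm_mk_lt (abs_lt.2 ht) hb

lemma continuousOn_mk_right {h : ℂ → ℝ} {r a : ℝ} (hh : ContinuousOn h (Metric.ball 0 r))
    (ha : |a| < r / 2) : ContinuousOn (fun t => h ⟨a, t⟩) (Set.Ioo (-(r / 2)) (r / 2)) := by
  refine hh.comp (f := fun t : ℝ => (⟨a, t⟩ : ℂ)) ?_ fun t ht => ?_
  · have : (fun t : ℝ => (⟨a, t⟩ : ℂ)) = fun t : ℝ => (a : ℂ) + t * Complex.I := by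
      ext t; exact Complex.mk_eq_add_mul_I a t
    rw [this]; fun_prop
  · rw [mem_ball_zero_iff]; exact norm_mk_lt ha (abs_lt.2 ht)

/-- The part of `phi` that depends on the harmonic function, times `-s`. -/
def harmonicPart (h : ℂ → ℝ) (a b : ℝ) : ℝ :=
  (∫ t in (0 : ℝ)..a, t * h ⟨t, b⟩) + ∫ t' in (0 : ℝ)..b, ∫ t in (0 : ℝ)..t', h ⟨0, t⟩

lemma hasDerivAt_harmonicPart_left {h : ℂ → ℝ} {r a b : ℝ}
    (hh : ContinuousOn h (Metric.ball 0 r)) (ha : |a| < r / 2) (hb : |b| < r / 2) :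
    HasDerivAt (fun a => harmonicPart h a b) (a * h ⟨a, b⟩) a :=
  (hasDerivAt_integral_of_continuousOn_Ioo (f := fun t => t * h ⟨t, b⟩)
    (continuousOn_id.mul (continuousOn_mk_left hh hb)) ha).add_const _

lemma hasDerivAt_mk_right {h : ℂ → ℝ} {a b : ℝ} (hh : DifferentiableAt ℝ h ⟨a, b⟩) :
    HasDerivAt (fun t => h ⟨a, t⟩) (fderiv ℝ h ⟨a, b⟩ Complex.I) b := by
  have h1 : HasDerivAt (fun t : ℝ => (⟨a, t⟩ : ℂ)) Complex.I b := by
    have : (fun t : ℝ => (⟨a, t⟩ : ℂ)) = fun t : ℝ => (a : ℂ) + t * Complex.I := by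
      ext t; exact Complex.mk_eq_add_mul_I a t
    rw [this]
    simpa using (((hasDerivAt_id b).ofReal_comp).mul_const Complex.I).const_add (a : ℂ)
  exact hh.hasFDerivAt.comp_hasDerivAt b h1

/-- Differentiation under the integral gives ∫₀ᵃ t ∂₂h dt, bounded by K'a², and the double integral
contributes ∫₀ᵇ h(0,t) dt, bounded by K|b|. The radius r/4 leaves room for a ball around b on which
the integrand is controlled. -/
lemma hasDerivAt_harmonicPart_right {h : ℂ → ℝ} {r a b K K' : ℝ}
    (hh : ContDiffOn ℝ 1 h (Metric.ball 0 r)) (ha : |a| < r / 4) (hb : |b| < r / 4)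
    (hK : ∀ y ∈ Metric.ball (0 : ℂ) r, |h y| ≤ K)
    (hK' : ∀ y ∈ Metric.ball (0 : ℂ) r, ‖fderiv ℝ h y‖ ≤ K') :
    ∃ d, |d| ≤ K' * a ^ 2 + K * |b| ∧ HasDerivAt (fun b => harmonicPart h a b) d b := by
  have hr : 0 < r := by linarith [abs_nonneg a]
  have hda : ∀ t ∈ Set.uIoc 0 a, |t| ≤ |a| := fun t ht => by
    have := Set.abs_sub_left_of_mem_uIcc (Set.uIoc_subset_uIcc ht)
    simpa using this
  have hball : ∀ t ∈ Set.uIoc 0 a, ∀ x ∈ Metric.ball b (r / 4),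
      (⟨t, x⟩ : ℂ) ∈ Metric.ball (0 : ℂ) r := fun t ht x hx => by
    rw [mem_ball_zero_iff]
    rw [Metric.mem_ball, Real.dist_eq] at hx
    exact norm_mk_lt (by linarith [hda t ht])
      (by linarith [abs_sub_abs_le_abs_sub x b])
  have hI : Set.uIoc 0 a ⊆ Set.Ioo (-(r / 2)) (r / 2) := fun t ht =>
    abs_lt.1 (by linarith [hda t ht])
  have hmeas : ∀ x, |x| < r / 2 → MeasureTheory.AEStronglyMeasurable (fun t => t * h ⟨t, x⟩)
      (MeasureTheory.volume.restrict (Set.uIoc 0 a)) := fun x hx =>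
    ((continuousOn_id.mul (continuousOn_mk_left hh.continuousOn hx)).mono
      hI).aestronglyMeasurable measurableSet_uIoc
  have hfd : ContinuousOn (fderiv ℝ h) (Metric.ball 0 r) :=
    hh.continuousOn_fderiv_of_isOpen Metric.isOpen_ball le_rfl
  have hfdI : ContinuousOn (fun y => fderiv ℝ h y Complex.I) (Metric.ball 0 r) :=
    hfd.clm_apply continuousOn_const
  have hbound : ∀ t ∈ Set.uIoc 0 a, ∀ x ∈ Metric.ball b (r / 4),
      ‖t * fderiv ℝ h ⟨t, x⟩ Complex.I‖ ≤ |a| * K' := fun t ht x hx => by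
    rw [norm_mul, Real.norm_eq_abs t]
    have h1 := (fderiv ℝ h ⟨t, x⟩).le_opNorm Complex.I
    rw [Complex.norm_I, mul_one] at h1
    exact mul_le_mul (hda t ht) (h1.trans (hK' _ (hball t ht x hx))) (norm_nonneg _) (abs_nonneg _)
  have hb0 : b ∈ Metric.ball b (r / 4) := Metric.mem_ball_self (by linarith)
  have key := intervalIntegral.hasDerivAt_integral_of_dominated_loc_of_deriv_le
    (μ := MeasureTheory.volume) (a := 0) (b := a) (F := fun x t => t * h ⟨t, x⟩)
    (F' := fun x t => t * fderiv ℝ h ⟨t, x⟩ Complex.I) (x₀ := b) (bound := fun _ => |a| * K')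
    (Metric.ball_mem_nhds b (by linarith : 0 < r / 4))
    (by
      filter_upwards [Metric.ball_mem_nhds b (by linarith : 0 < r / 4)] with x hx
      rw [Metric.mem_ball, Real.dist_eq] at hx
      exact hmeas x (by linarith [abs_sub_abs_le_abs_sub x b]))
    (by
      apply ContinuousOn.intervalIntegrable
      refine (continuousOn_id.mul (continuousOn_mk_left hh.continuousOn
        (by linarith : |b| < r / 2))).mono ?_
      have h' := abs_lt.1 ha
      exact Set.OrdConnected.uIcc_subset Set.ordConnected_Ioo ⟨by linarith, by linarith⟩
        ⟨by linarith, by linarith⟩)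
    (((continuousOn_id.mul (continuousOn_mk_left hfdI (by linarith : |b| < r / 2))).mono
      hI).aestronglyMeasurable measurableSet_uIoc)
    (.of_forall fun t ht x hx => hbound t ht x hx) intervalIntegrable_const
    (.of_forall fun t ht x hx => (hasDerivAt_mk_right
      ((hh.differentiableOn one_ne_zero).differentiableAt
        (Metric.isOpen_ball.mem_nhds (hball t ht x hx)))).const_mul t)
  have hin : ContinuousOn (fun t' => ∫ t in (0 : ℝ)..t', h ⟨0, t⟩) (Set.Ioo (-(r / 2)) (r / 2)) :=
    fun x hx => (hasDerivAt_integral_of_continuousOn_Ioo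
      (continuousOn_mk_right hh.continuousOn (by simpa using by linarith))
      (abs_lt.2 hx)).continuousAt.continuousWithinAt
  have h2 := hasDerivAt_integral_of_continuousOn_Ioo hin (by linarith : |b| < r / 2)
  refine ⟨_, ?_, key.2.add h2⟩
  refine (abs_add_le _ _).trans (add_le_add ?_ ?_)
  · have := intervalIntegral.norm_integral_le_of_norm_le_const fun t ht => hbound t ht b hb0
    rw [sub_zero, Real.norm_eq_abs] at this
    refine this.trans (le_of_eq ?_)
    rw [← sq_abs a]; ring
  · have := intervalIntegral.norm_integral_le_of_norm_le_const (a := 0) (b := b) (C := K)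
      (f := fun t => h ⟨0, t⟩) fun t ht => by
        refine hK _ ?_
        rw [mem_ball_zero_iff]
        have := Set.abs_sub_left_of_mem_uIcc (Set.uIoc_subset_uIcc ht)
        rw [sub_zero, sub_zero] at this
        exact norm_mk_lt (by simpa using by linarith) (by linarith)
    rwa [sub_zero, Real.norm_eq_abs] at this

/-! ### The potential `phi` and its partial derivatives -/

/-- The lower limit of the u₁-integral produces `basePhi` at u₂², which the distance sum in `psi`
cancels. What remains depends on u₁ and u₂ through u₁² + u₂², apart from the explicit terms. -/
lemma phi_eq {h : ℂ → ℝ} {r s : ℝ} (hs : 0 < s) (hh : ContinuousOn h (Metric.ball 0 r))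
    {u : Fin 3 → ℝ} (h0 : |u 0| < r / 2) (h1 : |u 1| < r / 2) (h2 : |u 2| ≤ 3 / 4 * s) :
    phi h s u = basePhi s (u 0 ^ 2 + u 1 ^ 2) (u 2)
      + (u 2 ^ 2 - u 1 ^ 2) / (4 * Real.pi * s) - harmonicPart h (u 0) (u 1) / s := by
  have hi : IntervalIntegrable (fun t => t * h ⟨t, u 1⟩ / s) MeasureTheory.volume 0 (u 0) := by
    apply IntervalIntegrable.div_const
    apply ContinuousOn.intervalIntegrable
    refine (continuousOn_id.mul (continuousOn_mk_left hh h1)).mono ?_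
    have h' := abs_lt.1 h0
    exact Set.OrdConnected.uIcc_subset Set.ordConnected_Ioo ⟨by linarith, by linarith⟩ h'
  have e : ∀ t, t * V h s ![t, u 1, u 2] = t * baseV s (t ^ 2 + u 1 ^ 2) (u 2)
      + t * h ⟨t, u 1⟩ / s := fun t => by
    rw [V_eq_baseV h hs]; simp; ring
  unfold phi
  simp only [e]
  rw [intervalIntegral.integral_add (intervalIntegrable_mul_baseV hs h2 _) hi,
    integral_mul_baseV hs h2, psi_eq_latticeDist h hs, intervalIntegral.integral_div]
  simp only [basePhi, harmonicPart]
  ring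

/-! ### Partial derivatives of `phi` -/

section Partial

variable {h : ℂ → ℝ} {r s : ℝ} {u : Fin 3 → ℝ}

lemma partialDeriv_phi_zero (hs : 0 < s) (hh : ContinuousOn h (Metric.ball 0 r))
    (h0 : |u 0| < r / 2) (h1 : |u 1| < r / 2) (h2 : |u 2| ≤ 3 / 4 * s)
    (hu : 0 < u 0 ^ 2 + u 1 ^ 2) :
    partialDeriv (phi h s) 0 u = -(u 0 * V h s u) := by
  have hev : (fun t => phi h s (Function.update u 0 t)) =ᶠ[nhds (u 0)] fun t =>
      basePhi s (t ^ 2 + u 1 ^ 2) (u 2) + (u 2 ^ 2 - u 1 ^ 2) / (4 * Real.pi * s)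
        - harmonicPart h t (u 1) / s := by
    filter_upwards [Ioo_mem_nhds (abs_lt.1 h0).1 (abs_lt.1 h0).2] with t ht
    rw [phi_eq hs hh (by simpa using abs_lt.2 ht) (by simpa using h1) (by simpa using h2)]
    simp
  have hd := ((hasDerivAt_basePhi_comp_sq hs h2 hu).add_const
    ((u 2 ^ 2 - u 1 ^ 2) / (4 * Real.pi * s))).sub
    ((hasDerivAt_harmonicPart_left hh h0 h1).div_const s)
  rw [partialDeriv, (hd.congr_of_eventuallyEq hev).deriv, V_eq_baseV h hs]
  ring

/-- The radial part contributes exactly -u₂ `baseV`. The error collects the h/s in `V`, the term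
-u₂²/(4πs), and the derivative of `harmonicPart`. -/
lemma abs_partialDeriv_phi_one_add_le {K K' : ℝ} (hs : 0 < s)
    (hh : ContDiffOn ℝ 1 h (Metric.ball 0 r))
    (hK : ∀ y ∈ Metric.ball (0 : ℂ) r, |h y| ≤ K)
    (hK' : ∀ y ∈ Metric.ball (0 : ℂ) r, ‖fderiv ℝ h y‖ ≤ K')
    (h0 : |u 0| < r / 4) (h1 : |u 1| < r / 4) (h2 : |u 2| ≤ 3 / 4 * s)
    (hu : 0 < u 0 ^ 2 + u 1 ^ 2) :
    |partialDeriv (phi h s) 1 u + u 1 * V h s u| ≤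
      (K' * u 0 ^ 2 + (2 * K + 1) * |u 1|) / s := by
  have hr : 0 < r := by linarith [abs_nonneg (u 0)]
  obtain ⟨d, hd, hd'⟩ := hasDerivAt_harmonicPart_right hh h0 h1 hK hK'
  have h1' : |u 1| < r / 2 := by linarith
  have hev : (fun t => phi h s (Function.update u 1 t)) =ᶠ[nhds (u 1)] fun t =>
      basePhi s (t ^ 2 + u 0 ^ 2) (u 2) + (u 2 ^ 2 - t ^ 2) / (4 * Real.pi * s)
        - harmonicPart h (u 0) t / s := by
    filter_upwards [Ioo_mem_nhds (abs_lt.1 h1').1 (abs_lt.1 h1').2] with t ht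
    rw [phi_eq hs hh.continuousOn (by simpa using by linarith) (by simpa using abs_lt.2 ht)
      (by simpa using h2)]
    simp [add_comm]
  rw [add_comm] at hu
  have hq : HasDerivAt (fun t => (u 2 ^ 2 - t ^ 2) / (4 * Real.pi * s))
      (-(2 * u 1) / (4 * Real.pi * s)) (u 1) := by
    simpa using (((hasDerivAt_id (u 1)).pow 2).const_sub (u 2 ^ 2)).div_const (4 * Real.pi * s)
  have hder := ((hasDerivAt_basePhi_comp_sq hs h2 hu).add hq).sub (hd'.div_const s)
  have hpi := Real.pi_gt_three
  have e : partialDeriv (phi h s) 1 u + u 1 * V h s u =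
      (u 1 * h ⟨u 0, u 1⟩ - u 1 / (2 * Real.pi) - d) / s := by
    rw [partialDeriv, (hder.congr_of_eventuallyEq hev).deriv, V_eq_baseV h hs, add_comm (u 0 ^ 2)]
    field_simp
    ring
  have hh0 : |h ⟨u 0, u 1⟩| ≤ K :=
    hK _ (by rw [mem_ball_zero_iff]; exact norm_mk_lt (by linarith) (by linarith))
  rw [e, abs_div, abs_of_pos hs]
  gcongr
  have a1 : |u 1 * h ⟨u 0, u 1⟩| ≤ K * |u 1| := by
    rw [abs_mul, mul_comm]; gcongr
  have a2 : |u 1 / (2 * Real.pi)| ≤ |u 1| := by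
    rw [abs_div]
    apply div_le_self (abs_nonneg _)
    rw [abs_of_pos (by positivity)]; linarith
  calc _ ≤ |u 1 * h ⟨u 0, u 1⟩| + |u 1 / (2 * Real.pi)| + |d| :=
        (abs_sub _ _).trans (add_le_add_left (abs_sub _ _) _)
    _ ≤ _ := by linarith

/-- The lattice slope, the n = 0 term u₃/|u| and the quadratic term 2u₃/s are each at most 1 in
absolute value, and they enter with weight 1/(4π). -/
lemma abs_partialDeriv_phi_two_le (hs : 0 < s) (hh : ContinuousOn h (Metric.ball 0 r))
    (h0 : |u 0| < r / 2) (h1 : |u 1| < r / 2) (h2 : |u 2| ≤ 1 / 2 * s)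
    (hu : 0 < u 0 ^ 2 + u 1 ^ 2) :
    |partialDeriv (phi h s) 2 u| ≤ 1 := by
  have h2' : |u 2| < 3 / 4 * s := by linarith
  have hev : (fun t => phi h s (Function.update u 2 t)) =ᶠ[nhds (u 2)] fun t =>
      basePhi s (u 0 ^ 2 + u 1 ^ 2) t + (t ^ 2 - u 1 ^ 2) / (4 * Real.pi * s)
        - harmonicPart h (u 0) (u 1) / s := by
    filter_upwards [Ioo_mem_nhds (abs_lt.1 h2').1 (abs_lt.1 h2').2] with t ht
    rw [phi_eq hs hh (by simpa using h0) (by simpa using h1) (by simpa using (abs_lt.2 ht).le)]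
    simp
  have hq : HasDerivAt (fun t => (t ^ 2 - u 1 ^ 2) / (4 * Real.pi * s))
      ((2 * u 2) / (4 * Real.pi * s)) (u 2) := by
    simpa using (((hasDerivAt_id (u 2)).pow 2).sub_const (u 1 ^ 2)).div_const (4 * Real.pi * s)
  have hder := ((hasDerivAt_basePhi_right hs h2' hu).add hq).sub_const
    (harmonicPart h (u 0) (u 1) / s)
  rw [partialDeriv, (hder.congr_of_eventuallyEq hev).deriv]
  have hx : |u 2 / s| ≤ 1 / 2 := abs_div_le_of_abs_le hs h2
  have a1 := abs_latticeSlope_le (q := (u 0 ^ 2 + u 1 ^ 2) / s ^ 2) (by positivity) hx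
  have a2 : |u 2 / √(u 0 ^ 2 + u 1 ^ 2 + u 2 ^ 2)| ≤ 1 := by
    rw [abs_div, abs_of_nonneg (Real.sqrt_nonneg _)]
    apply div_le_one_of_le₀ _ (Real.sqrt_nonneg _)
    apply Real.abs_le_sqrt
    linarith
  have hpi := Real.pi_gt_three
  rw [abs_le] at hx a1 a2 ⊢
  have e : ∀ A B : ℝ, -(1 / (4 * Real.pi)) * (A + B) + 2 * u 2 / (4 * Real.pi * s)
      = (1 / (4 * Real.pi)) * (-A - B + 2 * (u 2 / s)) := fun A B => by
    field_simp
    ring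
  rw [e]
  have hpos : 0 < 1 / (4 * Real.pi) := by positivity
  have hle : 1 / (4 * Real.pi) ≤ 1 / 12 := by
    apply one_div_le_one_div_of_le <;> linarith
  constructor <;> nlinarith

end Partial

/-! ### Estimates for `V` -/

section Estimates

variable {h : ℂ → ℝ} {s K : ℝ} {u : Fin 3 → ℝ}

lemma two_pi_mul_V (hs : 0 < s) (u : Fin 3 → ℝ) :
    2 * Real.pi * s * V h s u = latticeInv ((u 0 ^ 2 + u 1 ^ 2) / s ^ 2) (u 2 / s) / 2
      + s / (2 * √(u 0 ^ 2 + u 1 ^ 2 + u 2 ^ 2)) + Real.eulerMascheroniConstant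
      - Real.log 2 - Real.log s + 2 * Real.pi * h ⟨u 0, u 1⟩ := by
  have := Real.pi_pos
  rw [V_eq_latticeInv h hs, aConst, Real.log_mul two_ne_zero hs.ne']
  have e : ∀ A B C D : ℝ, 2 * Real.pi * s * (1 / (4 * Real.pi * s) * A
      + 1 / (4 * Real.pi * B) + C / (2 * Real.pi * s) + D / s) =
      A / 2 + s / (2 * B) + C + 2 * Real.pi * D := fun A B C D => by
    -- At the pole the convention 1/0 = 0 keeps the identity true.
    rcases eq_or_ne B 0 with rfl | hB
    · simp; field_simp; ring
    · field_simp; ring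
  rw [e]; ring

lemma log_two_le_one : Real.log 2 ≤ 1 := by linarith [Real.log_two_lt_d9]

/-- The n = 0 term is positive and is dropped, so no relation between m and s is required; the 3s
prevents a blow-up as m → 0. -/
lemma le_two_pi_mul_V {m : ℝ} (hs : 0 < s) (hm : 0 < m) (hu : u 0 ^ 2 + u 1 ^ 2 = m ^ 2)
    (h2 : |u 2| ≤ 1 / 2 * s) (hK : |h ⟨u 0, u 1⟩| ≤ K) :
    -Real.log (m + 3 * s) - (2 + 2 * Real.pi * K) ≤ 2 * Real.pi * s * V h s u := by
  have hpi := Real.pi_pos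
  rw [two_pi_mul_V hs, hu]
  have hx : |u 2 / s| ≤ 1 / 2 := abs_div_le_of_abs_le hs h2
  have a1 := le_latticeInv (q := m ^ 2 / s ^ 2) (by positivity) hx
  rw [← div_pow, Real.sqrt_sq (by positivity), show m / s + 3 = (m + 3 * s) / s by field_simp,
    Real.log_div (by positivity) hs.ne'] at a1
  have a2 : 0 ≤ s / (2 * √(m ^ 2 + u 2 ^ 2)) := by positivity
  have a3 := Real.one_half_lt_eulerMascheroniConstant
  have a4 : -(2 * Real.pi * K) ≤ 2 * Real.pi * h ⟨u 0, u 1⟩ := by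
    rw [← mul_neg]
    exact mul_le_mul_of_nonneg_left (abs_le.1 hK).1 (by positivity)
  have a5 := log_two_le_one
  rw [div_pow] at a1
  linarith

lemma abs_two_pi_mul_V_add_log_le {m : ℝ} (hs : 0 < s) (hm : s ≤ m)
    (hu : u 0 ^ 2 + u 1 ^ 2 = m ^ 2)
    (h2 : |u 2| ≤ 1 / 2 * s) (hK : |h ⟨u 0, u 1⟩| ≤ K) :
    |2 * Real.pi * s * V h s u + Real.log m| ≤ 8 + 2 * Real.pi * K := by
  have hpi := Real.pi_pos
  have hm0 : 0 < m := by linarith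
  have a5 := log_two_le_one
  rw [abs_le]
  constructor
  · have a1 := le_two_pi_mul_V hs hm0 hu h2 hK
    have a2 : Real.log (m + 3 * s) ≤ Real.log (2 ^ 2 * m) :=
      Real.log_le_log (by positivity) (by linarith)
    rw [Real.log_mul (by positivity) hm0.ne', Real.log_pow] at a2
    push_cast at a2
    linarith
  · rw [two_pi_mul_V hs, hu]
    have hx : |u 2 / s| ≤ 1 / 2 := abs_div_le_of_abs_le hs h2
    have a1 := latticeInv_le (q := m ^ 2 / s ^ 2) (by
      rw [← div_pow]; exact one_le_pow₀ ((one_le_div hs).2 hm)) hx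
    rw [← div_pow, Real.log_pow, Real.log_div hm0.ne' hs.ne', div_pow] at a1
    push_cast at a1
    have a2 : s / (2 * √(m ^ 2 + u 2 ^ 2)) ≤ 1 := by
      apply div_le_one_of_le₀ _ (by positivity)
      have : m ≤ √(m ^ 2 + u 2 ^ 2) := Real.le_sqrt_of_sq_le (by linarith [sq_nonneg (u 2)])
      linarith
    have a3 := Real.eulerMascheroniConstant_lt_two_thirds
    have a4 : 2 * Real.pi * h ⟨u 0, u 1⟩ ≤ 2 * Real.pi * K :=
      mul_le_mul_of_nonneg_left (abs_le.1 hK).2 (by positivity)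
    have a6 : Real.log 6 ≤ 5 := (Real.log_le_sub_one_of_pos (by norm_num)).trans (by norm_num)
    have a7 : 0 < Real.log 2 := Real.log_pos (by norm_num)
    linarith

end Estimates

/-! ### Pointwise description of the hyper-Kähler structure -/

namespace OVSpace

variable {h : ℂ → ℝ} {δ₀ s : ℝ} {X : Type*} [TopologicalSpace X] [ChartedSpace E4 X]
  [MulAction Circle X] (M : OVSpace h δ₀ s X) {x : X}

/-- The components of a tangent vector with respect to the coframe `du₁, du₂, du₃, α / 2π`. -/
def coframe (x : X) : TangentSpace (𝓡 4) x →ₗ[ℝ] (Fin 4 → ℝ) :=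
  LinearMap.pi ![(du s M.μ M.w 0 x).toLinearMap, (du s M.μ M.w 1 x).toLinearMap,
    (du s M.μ M.w 2 x).toLinearMap, (((1 / (2 * Real.pi)) • M.α x).toLinearMap)]

/-- The value of `V_s` at a point of the Ooguri-Vafa space. -/
def Vat (x : X) : ℝ := V h s (coord s M.μ M.w x)

lemma kahler_eq_coframe (hx : x ≠ M.o) (v v' : TangentSpace (𝓡 4) x) :
    M.kahler 0 x v v' = (M.coframe x v 0 * M.coframe x v' 3 - M.coframe x v' 0 * M.coframe x v 3)
      + M.Vat x * (M.coframe x v 1 * M.coframe x v' 2 - M.coframe x v' 1 * M.coframe x v 2) ∧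
    M.kahler 1 x v v' = (M.coframe x v 1 * M.coframe x v' 3 - M.coframe x v' 1 * M.coframe x v 3)
      + M.Vat x * (M.coframe x v 2 * M.coframe x v' 0 - M.coframe x v' 2 * M.coframe x v 0) ∧
    M.kahler 2 x v v' = (M.coframe x v 2 * M.coframe x v' 3 - M.coframe x v' 2 * M.coframe x v 3)
      + M.Vat x * (M.coframe x v 0 * M.coframe x v' 1 - M.coframe x v' 0 * M.coframe x v 1) := by
  refine ⟨?_, ?_, ?_⟩ <;> · rw [M.kahler_eq _ x hx]; rfl

/-- A vector killed by the coframe lies in the kernel of ω₁, which is nondegenerate because g is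
positive definite. -/
lemma coframe_injective (hx : x ≠ M.o) : Function.Injective (M.coframe x) := by
  rw [← LinearMap.ker_eq_bot, LinearMap.ker_eq_bot']
  intro v hv
  have hk : ∀ v', M.kahler 0 x v v' = 0 := fun v' => by
    rw [(M.kahler_eq_coframe hx v v').1, hv]; simp
  have hJ : M.J 0 x v = 0 := by
    by_contra hne
    have h1 := M.g_pos x _ hne
    rw [← M.kahler_eq_g_J, hk] at h1
    exact lt_irrefl _ h1
  have := M.J_sq 0 x v
  rw [hJ, map_zero] at this
  exact neg_eq_zero.1 this.symm

lemma coframe_surjective (hx : x ≠ M.o) : Function.Surjective (M.coframe x) := by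
  have hfd : FiniteDimensional ℝ (TangentSpace (𝓡 4) x) :=
    inferInstanceAs (FiniteDimensional ℝ E4)
  have hdim : Module.finrank ℝ (TangentSpace (𝓡 4) x) = Module.finrank ℝ (Fin 4 → ℝ) := by
    have : Module.finrank ℝ (TangentSpace (𝓡 4) x) = Module.finrank ℝ E4 := rfl
    rw [this]; simp
  exact (LinearMap.injective_iff_surjective_of_finrank_eq_finrank hdim).1 (M.coframe_injective hx)

/-- From J₃J₁ = J₂ follows ω₃(J₁v, ·) = ω₂(v, ·), which is read off on the dual basis. Factors of V
stay uncancelled because V ≠ 0 is not yet known. -/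
lemma coframe_J (hx : x ≠ M.o) (v : TangentSpace (𝓡 4) x) :
    M.Vat x * M.coframe x (M.J 0 x v) 0 = -M.coframe x v 3 ∧
    M.Vat x * M.coframe x (M.J 0 x v) 1 = -(M.Vat x * M.coframe x v 2) ∧
    M.coframe x (M.J 0 x v) 2 = M.coframe x v 1 ∧
    M.coframe x (M.J 0 x v) 3 = M.Vat x * M.coframe x v 0 := by
  have key : ∀ v', M.kahler 2 x (M.J 0 x v) v' = M.kahler 1 x v v' := fun v' => by
    rw [M.kahler_eq_g_J, M.kahler_eq_g_J]
    have := M.J_mul 2 x v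
    rw [show (2 : Fin 3) + 1 = 0 from rfl, show (2 : Fin 3) + 2 = 1 from rfl] at this
    rw [this]
  have key' : ∀ i : Fin 4, ∃ e : TangentSpace (𝓡 4) x, M.coframe x e = Pi.single i 1 :=
    fun i => M.coframe_surjective hx _
  choose e he using key'
  have k : ∀ i, _ := fun i => key (e i)
  simp only [(M.kahler_eq_coframe hx _ _).2.1, (M.kahler_eq_coframe hx _ _).2.2, he] at k
  have k0 := k 0
  have k1 := k 1
  have k2 := k 2
  have k3 := k 3
  simp at k0 k1 k2 k3
  refine ⟨?_, ?_, ?_, ?_⟩ <;> linarith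

lemma Vat_mul_g (hx : x ≠ M.o) (v v' : TangentSpace (𝓡 4) x) :
    M.Vat x * M.g x v v' = M.coframe x v 3 * M.coframe x v' 3
      + M.Vat x ^ 2 * (M.coframe x v 0 * M.coframe x v' 0 + M.coframe x v 1 * M.coframe x v' 1
        + M.coframe x v 2 * M.coframe x v' 2) := by
  have h1 : M.kahler 0 x (M.J 0 x v) v' = -M.g x v v' := by
    rw [M.kahler_eq_g_J, M.J_sq]; simp
  rw [(M.kahler_eq_coframe hx _ _).1] at h1
  obtain ⟨j0, j1, j2, j3⟩ := M.coframe_J hx v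
  rw [j2, j3] at h1
  linear_combination M.Vat x * h1 - M.coframe x v' 3 * j0 - M.Vat x * M.coframe x v' 2 * j1

/-- On the vector f dual to α/2π the previous formula reads V g(f, f) = 1. -/
lemma Vat_pos (hx : x ≠ M.o) : 0 < M.Vat x := by
  obtain ⟨e, he⟩ := M.coframe_surjective hx (Pi.single 0 1)
  obtain ⟨f, hf⟩ := M.coframe_surjective hx (Pi.single 3 1)
  have hf0 : f ≠ 0 := by
    rintro rfl
    rw [map_zero] at hf
    have := congrFun hf 3
    simp at this
  have h2 := M.g_pos x f hf0
  have h1 := M.Vat_mul_g hx f f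
  rw [hf] at h1
  simp at h1
  by_contra hneg
  nlinarith

lemma g_eq (hx : x ≠ M.o) (v v' : TangentSpace (𝓡 4) x) :
    M.g x v v' = M.coframe x v 3 * M.coframe x v' 3 / M.Vat x
      + M.Vat x * (M.coframe x v 0 * M.coframe x v' 0 + M.coframe x v 1 * M.coframe x v' 1
        + M.coframe x v 2 * M.coframe x v' 2) := by
  have h1 := M.Vat_mul_g hx v v'
  have h2 := (M.Vat_pos hx).ne'
  field_simp
  linarith

lemma mem_vert_iff (v : TangentSpace (𝓡 4) x) :
    v ∈ M.vert x ↔ M.coframe x v 0 = 0 ∧ M.coframe x v 1 = 0 := by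
  have : v ∈ M.vert x ↔ mvfderiv (𝓡 4) M.μ x v = 0 := Iff.rfl
  rw [this, Complex.ext_iff]
  rfl

lemma mem_horiz_iff (hx : x ≠ M.o) (v : TangentSpace (𝓡 4) x) :
    v ∈ M.horiz x ↔ M.coframe x v 2 = 0 ∧ M.coframe x v 3 = 0 := by
  have hV := M.Vat_pos hx
  have h0 : v ∈ M.horiz x ↔ ∀ v' ∈ M.vert x, M.g x v v' = 0 := Iff.rfl
  rw [h0]
  constructor
  · intro hv
    obtain ⟨e, he⟩ := M.coframe_surjective hx (Pi.single 2 1)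
    obtain ⟨f, hf⟩ := M.coframe_surjective hx (Pi.single 3 1)
    have h1 := hv e ((M.mem_vert_iff e).2 (by rw [he]; simp))
    have h2 := hv f ((M.mem_vert_iff f).2 (by rw [hf]; simp))
    rw [M.g_eq hx, he] at h1
    rw [M.g_eq hx, hf] at h2
    simp [hV.ne'] at h1 h2
    exact ⟨h1, h2⟩
  · rintro ⟨h2, h3⟩ v' hv'
    rw [mem_vert_iff] at hv'
    rw [M.g_eq hx, h2, h3, hv'.1, hv'.2]; simp

lemma gam_eq (hx : x ≠ M.o) (v : TangentSpace (𝓡 4) x) :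
    M.gam x v = -(partialDeriv (phi h s) 0 (coord s M.μ M.w x) / M.Vat x * M.coframe x v 3)
      - partialDeriv (phi h s) 1 (coord s M.μ M.w x) * M.coframe x v 2
      + partialDeriv (phi h s) 2 (coord s M.μ M.w x) * M.coframe x v 1 := by
  have hV := (M.Vat_pos hx).ne'
  obtain ⟨j0, j1, j2, j3⟩ := M.coframe_J hx v
  have e : M.gam x v = partialDeriv (phi h s) 0 (coord s M.μ M.w x) * M.coframe x (M.J 0 x v) 0
      + partialDeriv (phi h s) 1 (coord s M.μ M.w x) * M.coframe x (M.J 0 x v) 1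
      + partialDeriv (phi h s) 2 (coord s M.μ M.w x) * M.coframe x (M.J 0 x v) 2 := by
    have : M.gam x v = (∑ i : Fin 3, partialDeriv (phi h s) i (coord s M.μ M.w x) •
      du s M.μ M.w i x) (M.J 0 x v) := rfl
    rw [this, Fin.sum_univ_three]
    rfl
  have j0' : M.coframe x (M.J 0 x v) 0 = -M.coframe x v 3 / M.Vat x := by
    rw [eq_div_iff hV]; linarith
  have j1' : M.coframe x (M.J 0 x v) 1 = -M.coframe x v 2 := by
    apply mul_left_cancel₀ hV; linarith
  rw [e, j0', j1', j2]
  ring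

lemma norm_sq_mvfderiv_mu (v : TangentSpace (𝓡 4) x) :
    ‖mvfderiv (𝓡 4) M.μ x v‖ ^ 2 = M.coframe x v 0 ^ 2 + M.coframe x v 1 ^ 2 := by
  rw [← Complex.normSq_eq_norm_sq, Complex.normSq_apply, ← sq, ← sq]
  rfl

lemma gQuad_eq_of_mem_horiz (hx : x ≠ M.o) {v : TangentSpace (𝓡 4) x} (hv : v ∈ M.horiz x) :
    M.gQuad x v = M.Vat x * ‖mvfderiv (𝓡 4) M.μ x v‖ ^ 2 := by
  rw [mem_horiz_iff M hx] at hv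
  rw [gQuad, M.g_eq hx, norm_sq_mvfderiv_mu, hv.1, hv.2]
  ring

lemma abs_gam_le_of_mem_horiz (hx : x ≠ M.o) {v : TangentSpace (𝓡 4) x} (hv : v ∈ M.horiz x) :
    |M.gam x v| ≤ |partialDeriv (phi h s) 2 (coord s M.μ M.w x)| *
      ‖mvfderiv (𝓡 4) M.μ x v‖ := by
  rw [mem_horiz_iff M hx] at hv
  rw [gam_eq M hx, hv.1, hv.2]
  simp only [mul_zero, neg_zero, sub_zero, zero_add]
  rw [abs_mul]
  gcongr
  apply abs_le_of_sq_le_sq _ (norm_nonneg _)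
  rw [norm_sq_mvfderiv_mu]
  linarith [sq_nonneg (M.coframe x v 0)]

lemma covectorNorm_vert_sq (hx : x ≠ M.o) :
    covectorNorm (M.vert x) (M.gQuad x) (M.gam x) ^ 2 =
      ENNReal.ofReal (partialDeriv (phi h s) 0 (coord s M.μ M.w x) ^ 2 / M.Vat x
        + partialDeriv (phi h s) 1 (coord s M.μ M.w x) ^ 2 / M.Vat x) := by
  have hV := M.Vat_pos hx
  set p := partialDeriv (phi h s) 0 (coord s M.μ M.w x) with hp
  set p' := partialDeriv (phi h s) 1 (coord s M.μ M.w x) with hp'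
  have hgam : ∀ v ∈ M.vert x,
      M.gam x v = -(p / M.Vat x * M.coframe x v 3) - p' * M.coframe x v 2 := fun v hv => by
    rw [mem_vert_iff] at hv
    rw [gam_eq M hx, hv.2]; ring
  have hg : ∀ v ∈ M.vert x, M.gQuad x v =
      M.coframe x v 3 ^ 2 / M.Vat x + M.Vat x * M.coframe x v 2 ^ 2 := fun v hv => by
    rw [mem_vert_iff] at hv
    rw [gQuad, M.g_eq hx, hv.1, hv.2]; ring
  have hN : 0 ≤ p ^ 2 / M.Vat x + p' ^ 2 / M.Vat x := by positivity
  set N := √(p ^ 2 / M.Vat x + p' ^ 2 / M.Vat x) with hNdef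
  have hN2 : N ^ 2 = p ^ 2 / M.Vat x + p' ^ 2 / M.Vat x := Real.sq_sqrt hN
  rw [← hN2, ENNReal.ofReal_pow (Real.sqrt_nonneg _)]
  congr 1
  apply le_antisymm
  · refine iSup_le fun v => iSup_le fun hv => iSup_le fun hQ => ENNReal.ofReal_le_ofReal ?_
    rw [hg v hv] at hQ
    rw [hgam v hv]
    apply Real.abs_le_sqrt
    set a := M.coframe x v 3
    set b := M.coframe x v 2
    -- Cauchy–Schwarz through Lagrange's identity: the added square completes the product of the two
    -- norms.
    calc (-(p / M.Vat x * a) - p' * b) ^ 2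
        ≤ (-(p / M.Vat x * a) - p' * b) ^ 2 + (p * b - p' * a / M.Vat x) ^ 2 := by
          linarith [sq_nonneg (p * b - p' * a / M.Vat x)]
      _ = (p ^ 2 / M.Vat x + p' ^ 2 / M.Vat x) * (a ^ 2 / M.Vat x + M.Vat x * b ^ 2) := by
        field_simp; ring
      _ ≤ _ := mul_le_of_le_one_right hN hQ
  · rcases eq_or_ne N 0 with h0 | h0
    · rw [← hNdef, h0]; simp
    -- The supremum is attained at the normalized g-dual vector of γ_f.
    · obtain ⟨e, he⟩ := M.coframe_surjective hx ![0, 0, -(p' / (M.Vat x * N)), -(p / N)]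
      have c0 : M.coframe x e 0 = 0 := by rw [he]; rfl
      have c1 : M.coframe x e 1 = 0 := by rw [he]; rfl
      have c2 : M.coframe x e 2 = -(p' / (M.Vat x * N)) := by rw [he]; rfl
      have c3 : M.coframe x e 3 = -(p / N) := by rw [he]; rfl
      have hev : e ∈ M.vert x := (M.mem_vert_iff e).2 ⟨c0, c1⟩
      have hval : M.gam x e = N := by
        rw [hgam e hev, c2, c3]
        field_simp
        rw [hN2]; field_simp; ring
      have hQ : M.gQuad x e ≤ 1 := by
        rw [hg e hev, c2, c3]
        apply le_of_eq
        field_simp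
        rw [hN2]; field_simp
      refine le_trans ?_ (le_iSup_of_le e (le_iSup_of_le hev (le_iSup_of_le hQ le_rfl)))
      rw [hval]
      exact ENNReal.ofReal_le_ofReal (le_abs_self N)

end OVSpace

/-! ### The differential of the rescaling map -/

/-- With Q the squared length of the radial part of v, |Dv|² = (L|v|² - Q + Q/(4L))/(2πs) and 0 ≤ Q
≤ |v|². The loss occurs only in the radial direction, and L ≥ 1 makes the correction nonpositive. -/
lemma hasFDerivAt_zeta {s : ℝ} (hs : 0 < s) {y : ℂ} (hy : y ≠ 0) (hy1 : ‖y‖ < 1) :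
    ∃ D : ℂ →L[ℝ] ℂ, HasFDerivAt (zeta s) D y ∧
      ∀ v, (Real.log ‖y‖⁻¹ - 1) / (2 * Real.pi * s) * ‖v‖ ^ 2 ≤ ‖D v‖ ^ 2 ∧
        (1 ≤ Real.log ‖y‖⁻¹ → ‖D v‖ ^ 2 ≤ Real.log ‖y‖⁻¹ / (2 * Real.pi * s) * ‖v‖ ^ 2) := by
  have hpi := Real.pi_pos
  have hm : 0 < ‖y‖ := norm_pos_iff.2 hy
  have hL : 0 < Real.log ‖y‖⁻¹ := Real.log_pos ((one_lt_inv₀ hm).2 hy1)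
  set L := Real.log ‖y‖⁻¹ with hLdef
  set κ := 2 * Real.pi * s with hκ
  have hκ0 : 0 < κ := by positivity
  set c := √(L / κ) with hc
  have hc0 : 0 < c := Real.sqrt_pos.2 (by positivity)
  have hc2 : c ^ 2 = L / κ := Real.sq_sqrt (by positivity)
  have hsq : HasFDerivAt (fun z : ℂ => ‖z‖ ^ 2) (2 • innerSL ℝ y) y :=
    (hasStrictFDerivAt_norm_sq y).hasFDerivAt
  have hlog : HasFDerivAt (fun z : ℂ => Real.log ‖z‖⁻¹)
      (-(1 / ‖y‖ ^ 2) • innerSL ℝ y) y := by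
    have h1 := (hsq.log (by positivity)).const_mul (-(1 / 2))
    have e : (fun z : ℂ => Real.log ‖z‖⁻¹) = fun z : ℂ => -(1 / 2) * Real.log (‖z‖ ^ 2) := by
      ext z; rw [Real.log_inv, Real.log_pow]; push_cast; ring
    rw [e]
    refine h1.congr_fderiv ?_
    ext v
    simp
    field_simp
  have hcoef := ((hlog.const_mul κ⁻¹).sqrt (by positivity))
  have hcoef' : HasFDerivAt (fun z : ℂ => √(Real.log ‖z‖⁻¹ / κ))
      (-(1 / (2 * c * κ * ‖y‖ ^ 2)) • innerSL ℝ y) y := by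
    have e : (fun z : ℂ => √(Real.log ‖z‖⁻¹ / κ)) = fun z : ℂ => √(κ⁻¹ * Real.log ‖z‖⁻¹) := by
      ext z; rw [div_eq_inv_mul]
    rw [e]
    refine hcoef.congr_fderiv ?_
    have : √(κ⁻¹ * Real.log ‖y‖⁻¹) = c := by rw [hc, div_eq_inv_mul]
    rw [this]
    ext v
    simp
    field_simp
  have hz := hcoef'.smul (hasFDerivAt_id y)
  have ez : zeta s = fun z : ℂ => √(Real.log ‖z‖⁻¹ / κ) • z := by
    ext z
    rw [zeta, Complex.real_smul]
  rw [ez]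
  refine ⟨_, hz, fun v => ?_⟩
  set P := inner ℝ y v with hP
  have eD : (√(Real.log ‖y‖⁻¹ / κ) • ContinuousLinearMap.id ℝ ℂ
      + (-(1 / (2 * c * κ * ‖y‖ ^ 2)) • innerSL ℝ y).smulRight (id y)) v =
      c • v + (-(1 / (2 * c * κ * ‖y‖ ^ 2)) * P) • y := by
    simp [hP, hc, hLdef]
  have hnorm : ‖c • v + (-(1 / (2 * c * κ * ‖y‖ ^ 2)) * P) • y‖ ^ 2 =
      (L * ‖v‖ ^ 2 - P ^ 2 / ‖y‖ ^ 2 + P ^ 2 / ‖y‖ ^ 2 / (4 * L)) / κ := by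
    rw [norm_add_sq_real, norm_smul, norm_smul, mul_pow, mul_pow, Real.norm_eq_abs,
      Real.norm_eq_abs, sq_abs, sq_abs, inner_smul_left, inner_smul_right, real_inner_comm, ← hP]
    have e1 : L = κ * c ^ 2 := by rw [hc2]; field_simp
    simp only [conj_trivial]
    rw [e1]
    field_simp
    ring
  have hPle : P ^ 2 / ‖y‖ ^ 2 ≤ ‖v‖ ^ 2 := by
    rw [div_le_iff₀ (by positivity), ← mul_pow, ← sq_abs P, mul_comm]
    exact pow_le_pow_left₀ (abs_nonneg _) (abs_real_inner_le_norm y v) 2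
  have hP0 : 0 ≤ P ^ 2 / ‖y‖ ^ 2 := by positivity
  rw [eD, hnorm]
  set Q := P ^ 2 / ‖y‖ ^ 2
  constructor
  · rw [div_mul_eq_mul_div]
    gcongr
    have : 0 ≤ Q / (4 * L) := by positivity
    linarith
  · intro hL1
    rw [div_mul_eq_mul_div]
    gcongr
    have : Q / (4 * L) ≤ Q := div_le_self hP0 (by linarith)
    linarith

lemma OVSpace.pullQuad_eq {h : ℂ → ℝ} {δ₀ s : ℝ} {X : Type*} [TopologicalSpace X]
    [ChartedSpace E4 X] [MulAction Circle X] (M : OVSpace h δ₀ s X) {x : X} {D : ℂ →L[ℝ] ℂ}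
    (hD : HasFDerivAt (zeta s) D (M.μ x)) (v : TangentSpace (𝓡 4) x) :
    M.pullQuad x v = ‖D (mvfderiv (𝓡 4) M.μ x v)‖ ^ 2 := by
  have h1 : HasMFDerivAt (𝓡 4) 𝓘(ℝ, ℂ) M.μ x (mfderiv (𝓡 4) 𝓘(ℝ, ℂ) M.μ x) :=
    ((M.smooth_μ x).mdifferentiableAt (by simp)).hasMFDerivAt
  have h2 := (HasMFDerivAt.comp x hD.hasMFDerivAt h1).mfderiv
  have h3 : mvfderiv (𝓡 4) (fun z => zeta s (M.μ z)) x v = D (mvfderiv (𝓡 4) M.μ x v) := by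
    change mfderiv (𝓡 4) 𝓘(ℝ, ℂ) (zeta s ∘ M.μ) x v = _
    rw [h2]
    rfl
  rw [pullQuad, h3]

/-! ### Comparison with the Euclidean metric -/

lemma norm_zeta_sq {s : ℝ} (hs : 0 < s) {y : ℂ} (hy : y ≠ 0) (hy1 : ‖y‖ < 1) :
    ‖zeta s y‖ ^ 2 = Real.log ‖y‖⁻¹ / (2 * Real.pi * s) * ‖y‖ ^ 2 := by
  have hpi := Real.pi_pos
  have hm : 0 < ‖y‖ := norm_pos_iff.2 hy
  have hL : 0 < Real.log ‖y‖⁻¹ := Real.log_pos ((one_lt_inv₀ hm).2 hy1)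
  rw [zeta, norm_mul, Complex.norm_real, mul_pow, Real.norm_eq_abs, sq_abs,
    Real.sq_sqrt (by positivity)]

/-- As |y| < 1/2, the logarithm is at least log 2 > 0.69; then 18π/0.69 < 100 gives the constant 10.
-/
lemma norm_lt_of_norm_zeta_lt {s R : ℝ} (hs : 0 < s) (hR : 0 < R) {y : ℂ} (hy : y ≠ 0)
    (hy1 : ‖y‖ < 1 / 2) (hz : ‖zeta s y‖ < 3 * R) : ‖y‖ < 10 * R * √s := by
  have hpi := Real.pi_pos
  have hpi' := Real.pi_lt_d2
  have hm : 0 < ‖y‖ := norm_pos_iff.2 hy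
  have hL : 0.69 ≤ Real.log ‖y‖⁻¹ := by
    have h1 : Real.log 2 ≤ Real.log ‖y‖⁻¹ := by
      apply Real.log_le_log (by norm_num)
      rw [le_inv_comm₀ (by norm_num) hm]
      linarith
    linarith [Real.log_two_gt_d9]
  have h1 : ‖zeta s y‖ ^ 2 < (3 * R) ^ 2 := by gcongr
  rw [norm_zeta_sq hs hy (by linarith), div_mul_eq_mul_div, div_lt_iff₀ (by positivity)] at h1
  apply lt_of_pow_lt_pow_left₀ 2 (by positivity)
  rw [mul_pow, Real.sq_sqrt hs.le]
  have h2 : 0.69 * ‖y‖ ^ 2 ≤ Real.log ‖y‖⁻¹ * ‖y‖ ^ 2 := by gcongr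
  have h3 : (3 * R) ^ 2 * (2 * Real.pi * s) ≤ (3 * R) ^ 2 * (2 * 3.15 * s) := by gcongr
  have h4 : 0 < R ^ 2 * s := by positivity
  nlinarith

/-- If |y| < s, then log|y|⁻¹ |y|² ≤ 2|y|^{3/2} ≤ 2s^{3/2}, whereas |ζ|² ≥ √s demands at least
2πs^{3/2}. -/
lemma le_norm_of_le_norm_zeta {s : ℝ} (hs : 0 < s) {y : ℂ} (hy : y ≠ 0)
    (hy1 : ‖y‖ < 1) (hz : √(√s) ≤ ‖zeta s y‖) : s ≤ ‖y‖ := by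
  have hpi := Real.pi_gt_three
  have hm : 0 < ‖y‖ := norm_pos_iff.2 hy
  by_contra! hlt
  have h1 : √(√s) ^ 2 ≤ ‖zeta s y‖ ^ 2 := by gcongr
  rw [Real.sq_sqrt (Real.sqrt_nonneg _), norm_zeta_sq hs hy hy1, div_mul_eq_mul_div,
    le_div_iff₀ (by positivity)] at h1
  set m := ‖y‖
  have hsm : 0 < √m := Real.sqrt_pos.2 hm
  have hss : 0 < √s := Real.sqrt_pos.2 hs
  have h2 : Real.log m⁻¹ ≤ 2 * (√m)⁻¹ := by
    have a1 := Real.log_le_sub_one_of_pos (inv_pos.2 hsm)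
    rw [Real.log_inv, Real.log_sqrt hm.le] at a1
    rw [Real.log_inv]
    linarith
  have h3 : Real.log m⁻¹ * m ^ 2 ≤ 2 * (m * √m) := by
    calc Real.log m⁻¹ * m ^ 2 ≤ 2 * (√m)⁻¹ * m ^ 2 := by gcongr
      _ = 2 * (√m)⁻¹ * (m * (√m * √m)) := by rw [Real.mul_self_sqrt hm.le, sq]
      _ = _ := by field_simp
  have h4 : m * √m ≤ s * √s := by gcongr
  have h5 : 0 < s * √s := by positivity
  nlinarith

lemma covectorNorm_le {T : Type*} [AddCommGroup T] [Module ℝ T] [TopologicalSpace T]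
    {W : Submodule ℝ T} {Q : T → ℝ} {ℓ : T →L[ℝ] ℝ} {c : ℝ}
    (hc : ∀ v ∈ W, Q v ≤ 1 → |ℓ v| ≤ c) : covectorNorm W Q ℓ ≤ ENNReal.ofReal c :=
  iSup_le fun v => iSup_le fun hv => iSup_le fun hQ => ENNReal.ofReal_le_ofReal (hc v hv hQ)

/-- Perturbing one coordinate of `(a, b)` by at most `ε` times the norm changes the norm by a factor
between `1 - ε` and `1 + ε`. -/
lemma sq_add_sub_sq_bounds {a b m t ε : ℝ} (hm : 0 ≤ m) (hab : a ^ 2 + b ^ 2 = m ^ 2)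
    (ht : |t| ≤ ε * m) (hε1 : ε ≤ 1) :
    (1 - ε) ^ 2 * m ^ 2 ≤ a ^ 2 + (b - t) ^ 2 ∧ a ^ 2 + (b - t) ^ 2 ≤ (1 + ε) ^ 2 * m ^ 2 := by
  have hb : |b| ≤ m := abs_le_of_sq_le_sq (by linarith [sq_nonneg a]) hm
  have h1 : |b * t| ≤ m * |t| := by rw [abs_mul]; gcongr
  have h2 := abs_le.1 h1
  have h3 := sq_abs t
  have h4 := abs_nonneg t
  have e : a ^ 2 + (b - t) ^ 2 = m ^ 2 - 2 * (b * t) + |t| ^ 2 := by rw [h3, ← hab]; ring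
  rw [e]
  constructor
  · have h5 : ((1 - ε) * m) ^ 2 ≤ (m - |t|) ^ 2 :=
      pow_le_pow_left₀ (mul_nonneg (by linarith) hm) (by linarith) 2
    linarith
  · have h5 : (m + |t|) ^ 2 ≤ ((1 + ε) * m) ^ 2 :=
      pow_le_pow_left₀ (by positivity) (by linarith) 2
    linarith

/-- The factor (1 - ε)³ is generous here, since (1 + ε)(1 - ε)² ≤ 1; it is chosen to agree with
`vertical_comparison`. -/
lemma quadratic_comparison {ε Λ v n d : ℝ} (hε0 : 0 < ε) (hε : ε ≤ 1 / 2) (hΛ : 0 < Λ)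
    (hv : (1 - ε) * Λ ≤ v) (hv' : v ≤ (1 + ε) * Λ) (hn : 0 ≤ n) (hd : (1 - ε) * Λ * n ≤ d)
    (hd' : d ≤ Λ * n) : (1 - ε) ^ 3 * d ≤ v * n ∧ v * n ≤ ((1 - ε) ^ 3)⁻¹ * d := by
  have hε1 : 0 < 1 - ε := by linarith
  have hC : 0 < (1 - ε) ^ 3 := by positivity
  have hcube : (1 - ε) ^ 3 ≤ 1 - ε := pow_le_of_le_one hε1.le (by linarith) (by norm_num)
  rw [inv_mul_eq_div, le_div_iff₀ hC]
  constructor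
  · calc (1 - ε) ^ 3 * d ≤ (1 - ε) ^ 3 * (Λ * n) := by gcongr
      _ ≤ (1 - ε) * (Λ * n) := by gcongr
      _ = (1 - ε) * Λ * n := by ring
      _ ≤ v * n := by gcongr
  · calc v * n * (1 - ε) ^ 3 ≤ (1 + ε) * Λ * n * (1 - ε) ^ 3 := by gcongr
      _ = ((1 - ε) * Λ * n) * ((1 + ε) * (1 - ε) * (1 - ε)) := by ring
      _ ≤ ((1 - ε) * Λ * n) * 1 := by
        gcongr
        nlinarith
      _ ≤ d := by linarith

/-- The quantity equals v(a² + (b - t)²) with |t| ≤ εm. One factor 1 ± ε comes from v and two from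
the perturbed norm, and (1 + ε)³ ≤ (1 - ε)⁻³. -/
lemma vertical_comparison {ε Λ v a b m p : ℝ} (hε0 : 0 < ε) (hε : ε ≤ 1 / 2) (hΛ : 0 < Λ)
    (hv : (1 - ε) * Λ ≤ v) (hv' : v ≤ (1 + ε) * Λ) (hm : 0 ≤ m) (hab : a ^ 2 + b ^ 2 = m ^ 2)
    (hp : |p + b * v| ≤ ε * m * v) :
    (1 - ε) ^ 3 * (Λ * m ^ 2) ≤ (-(a * v)) ^ 2 / v + p ^ 2 / v ∧
      (-(a * v)) ^ 2 / v + p ^ 2 / v ≤ ((1 - ε) ^ 3)⁻¹ * (Λ * m ^ 2) := by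
  have hε1 : 0 < 1 - ε := by linarith
  have hC : 0 < (1 - ε) ^ 3 := by positivity
  have hv0 : 0 < v := lt_of_lt_of_le (by positivity) hv
  have ht : |(p + b * v) / v| ≤ ε * m := by
    rwa [abs_div, abs_of_pos hv0, div_le_iff₀ hv0]
  obtain ⟨h1, h2⟩ := sq_add_sub_sq_bounds hm hab ht (by linarith)
  have e : (-(a * v)) ^ 2 / v + p ^ 2 / v = v * (a ^ 2 + (b - (p + b * v) / v) ^ 2) := by
    field_simp
    ring
  rw [e]
  set N := a ^ 2 + (b - (p + b * v) / v) ^ 2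
  have hN : 0 ≤ N := by positivity
  constructor
  · calc (1 - ε) ^ 3 * (Λ * m ^ 2) = ((1 - ε) * Λ) * ((1 - ε) ^ 2 * m ^ 2) := by ring
      _ ≤ v * N := by gcongr
  · rw [inv_mul_eq_div, le_div_iff₀ hC]
    calc v * N * (1 - ε) ^ 3 ≤ ((1 + ε) * Λ) * ((1 + ε) ^ 2 * m ^ 2) * (1 - ε) ^ 3 := by gcongr
      _ = ((1 + ε) * (1 - ε)) ^ 3 * (Λ * m ^ 2) := by ring
      _ ≤ 1 * (Λ * m ^ 2) := by
        gcongr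
        apply pow_le_one₀ (by positivity)
        nlinarith
      _ = _ := one_mul _

section Pointwise

variable {h : ℂ → ℝ} {δ₀ s K₀ K₁ : ℝ} {X : Type*} [TopologicalSpace X] [ChartedSpace E4 X]
  [MulAction Circle X] (M : OVSpace h δ₀ s X) {x : X}

/-- A constant that controls all error terms. -/
def errorConst (K₀ K₁ : ℝ) : ℝ := 9 + 2 * Real.pi * K₀ + K₁ + 2 * K₀

lemma OVSpace.ne_o_of_mu_ne_zero (hx : M.μ x ≠ 0) : x ≠ M.o := by
  rintro rfl
  exact hx M.apply_o.1

lemma OVSpace.coord_sq (x : X) :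
    coord s M.μ M.w x 0 ^ 2 + coord s M.μ M.w x 1 ^ 2 = ‖M.μ x‖ ^ 2 := by
  rw [← Complex.normSq_eq_norm_sq, Complex.normSq_apply, ← sq, ← sq]
  rfl

lemma OVSpace.abs_coord_two_le (hs : 0 < s) (x : X) : |coord s M.μ M.w x 2| ≤ 1 / 2 * s := by
  have hpi := Real.pi_pos
  have : coord s M.μ M.w x 2 = s / (2 * Real.pi) * Complex.arg (M.w x) := rfl
  rw [this, abs_mul, abs_of_pos (by positivity)]
  calc s / (2 * Real.pi) * |Complex.arg (M.w x)| ≤ s / (2 * Real.pi) * Real.pi := by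
        gcongr; exact Complex.abs_arg_le_pi _
    _ = _ := by field_simp

/-- On horizontal vectors |γ(v)| ≤ |dμ(v)|, and both metrics dominate |dμ|²/(2πs): the first because
2πsV ≥ 1, the second because L - 1 ≥ 1. -/
lemma OVSpace.horizontal_estimates {r η : ℝ} (hs : 0 < s) (hK₀ : 0 ≤ K₀) (hK₁ : 0 ≤ K₁)
    (hh : ContDiffOn ℝ 1 h (Metric.ball 0 r)) (hr : r ≤ 1 / 2)
    (hb : ∀ y ∈ Metric.ball (0 : ℂ) r, |h y| ≤ K₀)
    (hx : M.μ x ≠ 0) (hη : ‖M.μ x‖ < η) (hηr : η < r / 4)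
    (hη1 : errorConst K₀ K₁ + 1 ≤ -Real.log (η + 3 * s)) (hη2 : 2 ≤ -Real.log η) :
    covectorNorm (M.horiz x) (M.gQuad x) (M.gam x) ≤ ENNReal.ofReal √(2 * Real.pi * s) ∧
      covectorNorm (M.horiz x) (M.pullQuad x) (M.gam x) ≤ ENNReal.ofReal √(2 * Real.pi * s) := by
  have hpi := Real.pi_pos
  have hxo := M.ne_o_of_mu_ne_zero hx
  have hm : 0 < ‖M.μ x‖ := norm_pos_iff.2 hx
  have h0 : |coord s M.μ M.w x 0| < r / 2 := by
    linarith [show |coord s M.μ M.w x 0| ≤ ‖M.μ x‖ from Complex.abs_re_le_norm _]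
  have h1 : |coord s M.μ M.w x 1| < r / 2 := by
    linarith [show |coord s M.μ M.w x 1| ≤ ‖M.μ x‖ from Complex.abs_im_le_norm _]
  have h2 := M.abs_coord_two_le hs x
  have hu := M.coord_sq x
  have hp := abs_partialDeriv_phi_two_le hs hh.continuousOn h0 h1 h2 (by rw [hu]; positivity)
  have hbx : |h ⟨coord s M.μ M.w x 0, coord s M.μ M.w x 1⟩| ≤ K₀ :=
    hb _ (by rw [mem_ball_zero_iff]; exact norm_mk_lt h0 h1)
  have hV := le_two_pi_mul_V hs hm hu h2 hbx
  have hV1 : 1 ≤ 2 * Real.pi * s * M.Vat x := by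
    have h3 : Real.log (‖M.μ x‖ + 3 * s) ≤ Real.log (η + 3 * s) :=
      Real.log_le_log (by positivity) (by linarith)
    have h4 : 2 + 2 * Real.pi * K₀ ≤ errorConst K₀ K₁ := by
      unfold errorConst; linarith
    have : M.Vat x = V h s (coord s M.μ M.w x) := rfl
    rw [this]
    linarith
  have hgam : ∀ v ∈ M.horiz x, |M.gam x v| ≤ ‖mvfderiv (𝓡 4) M.μ x v‖ := fun v hv =>
    (M.abs_gam_le_of_mem_horiz hxo hv).trans (mul_le_of_le_one_left (norm_nonneg _) hp)
  have hbound : ∀ v ∈ M.horiz x, ∀ c, 1 ≤ 2 * Real.pi * s * c →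
      c * ‖mvfderiv (𝓡 4) M.μ x v‖ ^ 2 ≤ 1 → |M.gam x v| ≤ √(2 * Real.pi * s) := by
    intro v hv c hc hc'
    refine (hgam v hv).trans (Real.le_sqrt_of_sq_le ?_)
    calc ‖mvfderiv (𝓡 4) M.μ x v‖ ^ 2 ≤ (2 * Real.pi * s * c) * ‖mvfderiv (𝓡 4) M.μ x v‖ ^ 2 :=
          le_mul_of_one_le_left (by positivity) hc
      _ = (2 * Real.pi * s) * (c * ‖mvfderiv (𝓡 4) M.μ x v‖ ^ 2) := by ring
      _ ≤ _ := mul_le_of_le_one_right (by positivity) hc'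
  constructor
  · refine covectorNorm_le fun v hv hQ => hbound v hv _ hV1 ?_
    rwa [M.gQuad_eq_of_mem_horiz hxo hv] at hQ
  · obtain ⟨D, hD, hDb⟩ := hasFDerivAt_zeta hs hx (by linarith)
    refine covectorNorm_le fun v hv hQ => hbound v hv
      ((Real.log ‖M.μ x‖⁻¹ - 1) / (2 * Real.pi * s)) ?_ ?_
    · rw [mul_div_cancel₀ _ (by positivity), Real.log_inv]
      linarith [Real.log_le_log hm hη.le]
    · rw [M.pullQuad_eq hD] at hQ
      exact (hDb _).1.trans hQ

lemma OVSpace.comparison_estimates {r η ε : ℝ} (hs : 0 < s) (hK₀ : 0 ≤ K₀) (hK₁ : 0 ≤ K₁)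
    (hh : ContDiffOn ℝ 1 h (Metric.ball 0 r)) (hr : r ≤ 1 / 2)
    (hb : ∀ y ∈ Metric.ball (0 : ℂ) r, |h y| ≤ K₀)
    (hb' : ∀ y ∈ Metric.ball (0 : ℂ) r, ‖fderiv ℝ h y‖ ≤ K₁)
    (hx : M.μ x ≠ 0) (hη : ‖M.μ x‖ < η) (hηr : η < r / 4) (hε0 : 0 < ε) (hε : ε ≤ 1 / 2)
    (hη1 : 4 * Real.pi * errorConst K₀ K₁ ≤ ε * (-Real.log η)) (hsx : s ≤ ‖M.μ x‖) :
    (∀ v ∈ M.horiz x, (1 - ε) ^ 3 * M.pullQuad x v ≤ M.gQuad x v ∧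
      M.gQuad x v ≤ ((1 - ε) ^ 3)⁻¹ * M.pullQuad x v) ∧
    ENNReal.ofReal ((1 - ε) ^ 3 * ‖zeta s (M.μ x)‖ ^ 2) ≤
      covectorNorm (M.vert x) (M.gQuad x) (M.gam x) ^ 2 ∧
    covectorNorm (M.vert x) (M.gQuad x) (M.gam x) ^ 2 ≤
      ENNReal.ofReal (((1 - ε) ^ 3)⁻¹ * ‖zeta s (M.μ x)‖ ^ 2) := by
  have hpi := Real.pi_gt_three
  have hxo := M.ne_o_of_mu_ne_zero hx
  have hm : 0 < ‖M.μ x‖ := norm_pos_iff.2 hx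
  have hc0 : |coord s M.μ M.w x 0| ≤ ‖M.μ x‖ := Complex.abs_re_le_norm _
  have hc1 : |coord s M.μ M.w x 1| ≤ ‖M.μ x‖ := Complex.abs_im_le_norm _
  have h2 := M.abs_coord_two_le hs x
  have hu := M.coord_sq x
  have hu0 : 0 < coord s M.μ M.w x 0 ^ 2 + coord s M.μ M.w x 1 ^ 2 := by rw [hu]; positivity
  have hbx : |h ⟨coord s M.μ M.w x 0, coord s M.μ M.w x 1⟩| ≤ K₀ :=
    hb _ (by rw [mem_ball_zero_iff]; exact norm_mk_lt (by linarith) (by linarith))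
  have hp0 := partialDeriv_phi_zero hs hh.continuousOn (by linarith) (by linarith)
    (by linarith) hu0
  have hp1 := abs_partialDeriv_phi_one_add_le hs hh hb hb' (by linarith) (by linarith)
    (by linarith) hu0
  have hV := abs_two_pi_mul_V_add_log_le hs hsx hu h2 hbx
  have hVpos := M.Vat_pos hxo
  have hVat : V h s (coord s M.μ M.w x) = M.Vat x := rfl
  have hzeta := norm_zeta_sq hs hx (by linarith)
  have hvert := M.covectorNorm_vert_sq hxo
  obtain ⟨D, hD, hDb⟩ := hasFDerivAt_zeta hs hx (by linarith)
  rw [hVat] at hp0 hp1 hV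
  rw [hp0] at hvert
  set p := partialDeriv (phi h s) 1 (coord s M.μ M.w x)
  set a := coord s M.μ M.w x 0
  set b := coord s M.μ M.w x 1
  set m := ‖M.μ x‖ with hmdef
  set v := M.Vat x
  set K := errorConst K₀ K₁ with hKdef
  set κ := 2 * Real.pi * s with hκ
  have hκ0 : 0 < κ := by positivity
  have hKK : 8 + 2 * Real.pi * K₀ ≤ K := by rw [hKdef, errorConst]; linarith
  have hK9 : 9 ≤ K := by
    have : 0 ≤ 2 * Real.pi * K₀ := by positivity
    rw [hKdef, errorConst]; linarith
  set L := Real.log m⁻¹ with hLdef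
  have hL : L = -Real.log m := Real.log_inv m
  have hLη : -Real.log η ≤ L := by rw [hL]; linarith [Real.log_le_log hm hη.le]
  have hεL : 4 * Real.pi * K ≤ ε * L := hη1.trans (by gcongr)
  have hKL : K ≤ ε * L := le_trans (by nlinarith) hεL
  have hL0 : 0 < L := by
    by_contra! hneg
    nlinarith
  have hL1 : 1 ≤ L := by nlinarith
  set Λ := L / κ with hΛ
  have hΛ0 : 0 < Λ := by positivity
  have hVl : (1 - ε) * Λ ≤ v := by
    rw [hΛ, mul_div_assoc', div_le_iff₀ hκ0]
    linarith [(abs_le.1 hV).1]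
  have hVu : v ≤ (1 + ε) * Λ := by
    rw [hΛ, mul_div_assoc', le_div_iff₀ hκ0]
    linarith [(abs_le.1 hV).2]
  have hm1 : m ≤ 1 := by linarith
  have ht : |p + b * v| ≤ ε * m * v := by
    refine hp1.trans ?_
    have e1 : K₁ * a ^ 2 + (2 * K₀ + 1) * |b| ≤ K * m := by
      have ha : a ^ 2 ≤ m := by
        have : m ^ 2 ≤ m := pow_le_of_le_one hm.le hm1 two_ne_zero
        linarith [sq_nonneg b]
      have h3 : K₁ * a ^ 2 ≤ K₁ * m := by gcongr
      have h4 : (2 * K₀ + 1) * |b| ≤ (2 * K₀ + 1) * m := by gcongr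
      have h5 : K₁ + (2 * K₀ + 1) ≤ K := by
        have : 0 ≤ 2 * Real.pi * K₀ := by positivity
        rw [hKdef, errorConst]; linarith
      have h6 : (K₁ + (2 * K₀ + 1)) * m ≤ K * m := by gcongr
      linarith
    -- The factor 4π in the hypothesis on ε is used up here: K/s = 4πK/(2κ) ≤ εΛ/2, and Λ/2 ≤ (1 -
    -- ε)Λ ≤ v because ε ≤ 1/2.
    calc (K₁ * a ^ 2 + (2 * K₀ + 1) * |b|) / s ≤ K * m / s := by gcongr
      _ = (4 * Real.pi * K) / (2 * κ) * m := by rw [hκ]; field_simp; ring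
      _ ≤ (ε * L) / (2 * κ) * m := by gcongr
      _ = ε * m * ((1 - 1 / 2) * Λ) := by rw [hΛ]; field_simp; ring
      _ ≤ ε * m * v := by
        gcongr
        refine le_trans ?_ hVl
        gcongr
  obtain ⟨hlow, hupp⟩ := vertical_comparison hε0 hε hΛ0 hVl hVu hm.le hu ht
  refine ⟨fun w hw => ?_, ?_, ?_⟩
  · rw [M.gQuad_eq_of_mem_horiz hxo hw, M.pullQuad_eq hD]
    obtain ⟨d1, d2⟩ := hDb (mvfderiv (𝓡 4) M.μ x w)
    refine quadratic_comparison hε0 hε hΛ0 hVl hVu (sq_nonneg _) (le_trans ?_ d1) (d2 hL1)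
    refine mul_le_mul_of_nonneg_right ?_ (sq_nonneg _)
    rw [hΛ, mul_div_assoc']
    exact div_le_div_of_nonneg_right (by linarith) hκ0.le
  · rw [hvert, hzeta]
    exact ENNReal.ofReal_le_ofReal hlow
  · rw [hvert, hzeta]
    exact ENNReal.ofReal_le_ofReal hupp

end Pointwise

/-! ### Choice of the constants -/

lemma tendsto_mul_sqrt_nhdsGT {R : ℝ} (hR : 0 < R) :
    Filter.Tendsto (fun s => 10 * R * √s) (nhdsWithin 0 (Set.Ioi 0))
      (nhdsWithin 0 (Set.Ioi 0)) := by
  refine tendsto_nhdsWithin_iff.2 ⟨?_, ?_⟩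
  · have : Filter.Tendsto (fun s => 10 * R * √s) (nhds 0) (nhds (10 * R * √0)) :=
      (Continuous.tendsto (by fun_prop) 0)
    rw [Real.sqrt_zero, mul_zero] at this
    exact this.mono_left nhdsWithin_le_nhds
  · filter_upwards [self_mem_nhdsWithin] with s hs
    have := Real.sqrt_pos.2 hs
    exact Set.mem_Ioi.2 (by positivity)

lemma tendsto_neg_log_mul_sqrt {R : ℝ} (hR : 0 < R) :
    Filter.Tendsto (fun s => -Real.log (10 * R * √s)) (nhdsWithin 0 (Set.Ioi 0)) Filter.atTop :=
  Filter.tendsto_neg_atBot_atTop.comp (Real.tendsto_log_nhdsGT_zero.comp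
    (tendsto_mul_sqrt_nhdsGT hR))

/-- The relative error in the comparison with the Euclidean metric. -/
def relError (K s R : ℝ) : ℝ := 4 * Real.pi * K / -Real.log (10 * R * √s)

lemma tendsto_relError (K : ℝ) {R : ℝ} (hR : 0 < R) :
    Filter.Tendsto (fun s => relError K s R) (nhdsWithin 0 (Set.Ioi 0)) (nhds 0) :=
  (tendsto_neg_log_mul_sqrt hR).const_div_atTop _

lemma exists_threshold (K : ℝ) {r : ℝ} (hr : 0 < r) (R : ℝ) : ∃ S, 0 < S ∧
    (0 < R → ∀ s, 0 < s → s ≤ S → 10 * R * √s < r / 4 ∧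
      K + 1 ≤ -Real.log (10 * R * √s + 3 * s) ∧ 2 ≤ -Real.log (10 * R * √s) ∧
      relError K s R ≤ 1 / 2) := by
  -- Nonpositive R gets a dummy threshold, so that a choice over all real R is possible.
  by_cases hR : 0 < R
  swap
  · exact ⟨1, one_pos, fun h => absurd h hR⟩
  have t1 := tendsto_mul_sqrt_nhdsGT hR
  have t2 : Filter.Tendsto (fun s => -Real.log (10 * R * √s + 3 * s)) (nhdsWithin 0 (Set.Ioi 0))
      Filter.atTop := by
    refine Filter.tendsto_neg_atBot_atTop.comp (Real.tendsto_log_nhdsGT_zero.comp ?_)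
    refine tendsto_nhdsWithin_iff.2 ⟨?_, ?_⟩
    · have : Filter.Tendsto (fun s => 10 * R * √s + 3 * s) (nhds 0)
          (nhds (10 * R * √0 + 3 * 0)) := (Continuous.tendsto (by fun_prop) 0)
      rw [Real.sqrt_zero, mul_zero, mul_zero, add_zero] at this
      exact this.mono_left nhdsWithin_le_nhds
    · filter_upwards [self_mem_nhdsWithin] with s hs
      have hs' : 0 < s := hs
      exact Set.mem_Ioi.2 (by positivity)
  have hev : ∀ᶠ s in nhdsWithin (0 : ℝ) (Set.Ioi 0), 10 * R * √s < r / 4 ∧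
      K + 1 ≤ -Real.log (10 * R * √s + 3 * s) ∧ 2 ≤ -Real.log (10 * R * √s) ∧
      relError K s R ≤ 1 / 2 :=
    ((t1.mono_right nhdsWithin_le_nhds).eventually_lt_const (by positivity)).and
      ((t2.eventually_ge_atTop _).and (((tendsto_neg_log_mul_sqrt hR).eventually_ge_atTop _).and
        ((tendsto_relError K hR).eventually_le_const (by norm_num))))
  obtain ⟨S, hS, hS'⟩ := mem_nhdsGT_iff_exists_Ioc_subset.1 hev
  exact ⟨S, hS, fun _ s h1 h2 => hS' ⟨h1, h2⟩⟩

end OoguriVafa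
end

open OoguriVafa in
theorem proposition6p13 (δ₀ : ℝ) (hδ₀ : 0 < δ₀) (hδ₀' : δ₀ ≤ 1 / 2) (h : ℂ → ℝ)
    (hh : InnerProductSpace.HarmonicOnNhd h (Metric.ball 0 δ₀))
    (hb : ∀ y ∈ Metric.ball (0 : ℂ) δ₀, |h y| ≤ 1 / (10 * Real.pi) * Real.log δ₀⁻¹) :
    ∃ (sR : ℝ → ℝ) (C δ : ℝ → ℝ → ℝ) (σ : ℝ → ℝ),
      (∀ R, 0 < R → 0 < sR R) ∧
      (∀ R, 0 < R → ∀ s, 0 < s → s ≤ sR R → 0 < C s R ∧ 0 < σ s ∧ 0 < δ s R) ∧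
      (∀ R, 0 < R → Filter.Tendsto (fun s => C s R) (nhdsWithin 0 (Set.Ioi 0)) (nhds 1)) ∧
      (∀ R, 0 < R → Filter.Tendsto (fun s => δ s R) (nhdsWithin 0 (Set.Ioi 0)) (nhds 0)) ∧
      Filter.Tendsto σ (nhdsWithin 0 (Set.Ioi 0)) (nhds 0) ∧
      ∀ R, 0 < R → ∀ s, 0 < s → s ≤ sR R →
        ∀ (X : Type*) [TopologicalSpace X] [T2Space X] [SecondCountableTopology X]
          [ChartedSpace E4 X] [IsManifold (𝓡 4) ∞ X] [MulAction Circle X]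
          (M : OVSpace h δ₀ s X) (q : X),
          M.μ q ≠ 0 → ‖zeta s (M.μ q)‖ < 3 * R →
            (covectorNorm (M.horiz q) (M.gQuad q) (M.gam q) ≤ ENNReal.ofReal (δ s R) ∧
              covectorNorm (M.horiz q) (M.pullQuad q) (M.gam q) ≤ ENNReal.ofReal (δ s R)) ∧
            (σ s ≤ ‖zeta s (M.μ q)‖ →
              (∀ v ∈ M.horiz q,
                (C s R)⁻¹ * M.pullQuad q v ≤ M.gQuad q v ∧
                  M.gQuad q v ≤ C s R * M.pullQuad q v) ∧
              ENNReal.ofReal ((C s R)⁻¹ * ‖zeta s (M.μ q)‖ ^ 2) ≤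
                covectorNorm (M.vert q) (M.gQuad q) (M.gam q) ^ 2 ∧
              covectorNorm (M.vert q) (M.gQuad q) (M.gam q) ^ 2 ≤
                ENNReal.ofReal (C s R * ‖zeta s (M.μ q)‖ ^ 2)) := by
  set K₀ := 1 / (10 * Real.pi) * Real.log δ₀⁻¹ with hK₀def
  have hpi := Real.pi_pos
  have hK₀ : 0 ≤ K₀ := by
    have : 0 ≤ Real.log δ₀⁻¹ := Real.log_nonneg ((one_le_inv₀ hδ₀).2 (by linarith))
    positivity
  have hcd : ContDiffOn ℝ 1 h (Metric.ball 0 δ₀) := hh.contDiffOn.of_le (by norm_num)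
  have hsub : Metric.closedBall (0 : ℂ) (δ₀ / 2) ⊆ Metric.ball 0 δ₀ :=
    Metric.closedBall_subset_ball (by linarith)
  -- The gradient of h may be unbounded near the boundary of the disc, hence the passage to half the
  -- radius; the relevant y tend to 0 with s anyway.
  obtain ⟨K₁, hK₁⟩ := (isCompact_closedBall (0 : ℂ) (δ₀ / 2)).exists_bound_of_continuousOn
    ((hcd.continuousOn_fderiv_of_isOpen Metric.isOpen_ball le_rfl).mono hsub)
  have hK₁0 : 0 ≤ K₁ :=
    (norm_nonneg _).trans (hK₁ 0 (Metric.mem_closedBall_self (by positivity)))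
  have hsub' : Metric.ball (0 : ℂ) (δ₀ / 2) ⊆ Metric.ball 0 δ₀ :=
    Metric.ball_subset_closedBall.trans hsub
  have hcd' := hcd.mono hsub'
  have hbr : ∀ y ∈ Metric.ball (0 : ℂ) (δ₀ / 2), |h y| ≤ K₀ := fun y hy => hb y (hsub' hy)
  have hbr' : ∀ y ∈ Metric.ball (0 : ℂ) (δ₀ / 2), ‖fderiv ℝ h y‖ ≤ K₁ := fun y hy =>
    hK₁ y (Metric.ball_subset_closedBall hy)
  set K := errorConst K₀ K₁ with hK
  have hK0 : 0 < K := by rw [hK, errorConst]; positivity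
  choose S hS hS' using exists_threshold K (half_pos hδ₀)
  have hrel : ∀ R, 0 < R → ∀ s, 0 < s → s ≤ S R → 0 < relError K s R := fun R hR s hs hsR => by
    have := (hS' R hR s hs hsR).2.2.1
    exact div_pos (by positivity) (by linarith)
  -- C is the comparison factor for ε = `relError`, δ = √(2πs) comes from the horizontal bound, and
  -- σ = s^{1/4} is what forces |y| ≥ s.
  refine ⟨S, fun s R => ((1 - relError K s R) ^ 3)⁻¹, fun s _ => √(2 * Real.pi * s),
    fun s => √(√s), fun R _ => hS R, fun R hR s hs hsR => ⟨?_, by positivity, by positivity⟩,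
    fun R hR => ?_, fun R _ => ?_, ?_, ?_⟩
  · have := (hS' R hR s hs hsR).2.2.2
    have : 0 < 1 - relError K s R := by linarith
    positivity
  · have := ((((tendsto_relError K hR).const_sub 1).pow 3).inv₀ (by norm_num))
    simpa using this
  · have : Filter.Tendsto (fun s => √(2 * Real.pi * s)) (nhds 0)
      (nhds √(2 * Real.pi * 0)) := Continuous.tendsto (by fun_prop) 0
    rw [mul_zero, Real.sqrt_zero] at this
    exact this.mono_left nhdsWithin_le_nhds
  · have : Filter.Tendsto (fun s => √(√s)) (nhds 0) (nhds √(√0)) :=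
      Continuous.tendsto (by fun_prop) 0
    rw [Real.sqrt_zero, Real.sqrt_zero] at this
    exact this.mono_left nhdsWithin_le_nhds
  · intro R hR s hs hsR X _ _ _ _ _ _ M q hq hqR
    obtain ⟨c1, c2, c3, c4⟩ := hS' R hR s hs hsR
    have hq2 : ‖M.μ q‖ < 1 / 2 := (M.mem_disc q).trans_le hδ₀'
    have hη := norm_lt_of_norm_zeta_lt hs hR hq hq2 hqR
    refine ⟨M.horizontal_estimates hs hK₀ hK₁0 hcd' (by linarith) hbr hq hη c1 c2 c3,
      fun hσ => ?_⟩
    have hsq := le_norm_of_le_norm_zeta hs hq (by linarith) hσ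
    rw [inv_inv]
    refine M.comparison_estimates hs hK₀ hK₁0 hcd' (by linarith) hbr hbr' hq hη c1
      (hrel R hR s hs hsR) c4 (le_of_eq ?_) hsq
    rw [relError, div_mul_cancel₀]
    linarith
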